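/- An Arveson system is a measurable family $\mathcal E=(\mathcal E_t)_{t\ge 0}$ of separable complex Hilbert spaces with a measurable family of unitaries $V_{s,t}:\mathcal E_s\otimes\mathcal E_t\to\mathcal E_{s+t}$ $(s,t\ge 0)$ such that $V_{r,s+t}(1\otimes V_{s,t})=V_{r+s,t}(V_{r,s}\otimes 1)$; one writes $x\cdot y$ for $V_{s,t}(x\otimes y)$. The tensor product $\mathcal E\otimes\mathcal F$ of two Arveson systems has the fibers $\mathcal E_t\otimes\mathcal F_t$ and the product $(x\otimes y)\cdot(x'\otimes y')=(x\cdot x')\otimes(y\cdot y')$. A product subsystem of $\mathcal E$ is a family of closed subspaces $\mathcal H_t\subseteq\mathcal E_t$ with $V_{s,t}(\mathcal H_s\otimes\mathcal H_t)=\mathcal H_{s+t}$ for all $s,t\ge0$; the product subsystems form a complete lattice under inclusion, with pointwise intersection as meet. A unit of $\mathcal E$ is a measurable section $u=(u_t)_{t\ge0}$ of non-zero vectors $u_t\in\mathcal E_t$ with $u_{s+t}=u_s\cdot u_t$ for all $s,t\ge 0$; it is unital if $\|u_t\|=1$ for all $t$. A spatial Arveson system is a pair $(\mathcal E,u)$ of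 an Arveson system and a unital unit of it. The spatial product of $(\mathcal E,u)$ and $(\mathcal F,v)$ is the smallest product subsystem $\mathcal E\,{}_u\!\otimes_v\mathcal F:=(u\otimes\mathcal F)\vee(\mathcal E\otimes v)$ of $\mathcal E\otimes\mathcal F$ that contains the subsystems $u\otimes\mathcal F=(u_t\otimes\mathcal F_t)_{t\ge0}$ and $\mathcal E\otimes v=(\mathcal E_t\otimes v_t)_{t\ge0}$. Corollary. Let $(\mathcal E,u)$ and $(\mathcal F,v)$ be spatial Arveson systems. Suppose that $\mathcal F$ is of type I, that is, $\mathcal F=\mathcal F^0$, where $\mathcal F^0$ is the smallest product subsystem of $\mathcal F$ that contains all units of $\mathcal F$. Then $\mathcal E\,{}_u\!\otimes_v\mathcal F=\mathcal E\otimes\mathcal F$ as subsystems of $\mathcal E\otimes\mathcal F$. -/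

import Mathlib

open scoped NNReal TensorProduct

universe u v w

/-! ### Total families and unitaries determined by them -/

section Total

variable {ι : Type*} {X Y : Type*}
  [NormedAddCommGroup X] [InnerProductSpace ℂ X]
  [NormedAddCommGroup Y] [InnerProductSpace ℂ Y]

/-- A set of vectors is total if its closed linear span is the whole space. -/
def IsTotalSet (S : Set X) : Prop :=
  (Submodule.span ℂ S).topologicalClosure = ⊤

theorem IsTotalSet.dense {S : Set X} (h : IsTotalSet S) :
    Dense (Submodule.span ℂ S : Set X) :=
  Submodule.dense_iff_topologicalClosure_eq_top.mpr h

theorem IsTotalSet.mem_of_isClosed {S : Set X} (h : IsTotalSet S) (W : Submodule ℂ X)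
    (hW : IsClosed (W : Set X)) (hS : ∀ x ∈ S, x ∈ W) (x : X) : x ∈ W := by
  have h1 : (Submodule.span ℂ S).topologicalClosure ≤ W :=
    Submodule.topologicalClosure_minimal _ (Submodule.span_le.mpr hS) hW
  rw [h] at h1
  exact h1 trivial

theorem isTotalSet_iff [CompleteSpace X] {S : Set X} :
    IsTotalSet S ↔ ∀ x : X, (∀ a ∈ S, inner ℂ a x = 0) → x = 0 := by
  unfold IsTotalSet
  rw [Submodule.topologicalClosure_eq_top_iff, Submodule.eq_bot_iff]
  refine forall_congr' fun x => imp_congr ?_ Iff.rfl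
  rw [Submodule.mem_orthogonal]
  constructor
  · exact fun h a ha => h a (Submodule.subset_span ha)
  · intro h a ha
    induction ha using Submodule.span_induction with
    | mem a ha => exact h a ha
    | zero => simp
    | add a b _ _ ha hb => simp [inner_add_left, ha, hb]
    | smul c a _ ha => simp [inner_smul_left, ha]

theorem denseRange_linearCombination {a : ι → X} (ha : IsTotalSet (Set.range a)) :
    DenseRange (Finsupp.linearCombination ℂ a) := by
  have := ha.dense
  rw [← Finsupp.range_linearCombination] at this
  rwa [LinearMap.coe_range] at this

theorem norm_linearCombination_eq {a : ι → X} {b : ι → Y}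
    (h : ∀ i j, inner ℂ (a i) (a j) = inner ℂ (b i) (b j)) (c : ι →₀ ℂ) :
    ‖Finsupp.linearCombination ℂ b c‖ = ‖Finsupp.linearCombination ℂ a c‖ := by
  have key : inner ℂ (Finsupp.linearCombination ℂ b c) (Finsupp.linearCombination ℂ b c)
      = inner ℂ (Finsupp.linearCombination ℂ a c) (Finsupp.linearCombination ℂ a c) := by
    simp only [Finsupp.linearCombination_apply, Finsupp.sum, sum_inner, inner_sum,
      inner_smul_left, inner_smul_right, h]
  rw [norm_eq_sqrt_re_inner (𝕜 := ℂ), norm_eq_sqrt_re_inner (𝕜 := ℂ), key]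

/-- Two total families with the same Gram matrix are intertwined by a unitary. -/
noncomputable def unitaryOfGram [CompleteSpace X] [CompleteSpace Y] (a : ι → X) (b : ι → Y)
    (ha : IsTotalSet (Set.range a)) (hb : IsTotalSet (Set.range b))
    (h : ∀ i j, inner ℂ (a i) (a j) = inner ℂ (b i) (b j)) : X ≃ₗᵢ[ℂ] Y :=
  (LinearEquiv.refl ℂ (ι →₀ ℂ)).extendOfIsometry
    (Finsupp.linearCombination ℂ a) (Finsupp.linearCombination ℂ b)
    (denseRange_linearCombination ha) (denseRange_linearCombination hb)
    (norm_linearCombination_eq h)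

theorem unitaryOfGram_apply [CompleteSpace X] [CompleteSpace Y] (a : ι → X) (b : ι → Y)
    (ha : IsTotalSet (Set.range a)) (hb : IsTotalSet (Set.range b))
    (h : ∀ i j, inner ℂ (a i) (a j) = inner ℂ (b i) (b j)) (i : ι) :
    unitaryOfGram a b ha hb h (a i) = b i := by
  have := LinearEquiv.extendOfIsometry_eq (LinearEquiv.refl ℂ (ι →₀ ℂ))
    (Finsupp.linearCombination ℂ a) (Finsupp.linearCombination ℂ b)
    (denseRange_linearCombination ha) (denseRange_linearCombination hb)
    (norm_linearCombination_eq h) (Finsupp.single i 1)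
  simpa [unitaryOfGram] using this

end Total

/-! ### The Hilbert space tensor product -/

section HilbertTensor

variable (H : Type*) (K : Type*)
  [NormedAddCommGroup H] [InnerProductSpace ℂ H]
  [NormedAddCommGroup K] [InnerProductSpace ℂ K]

/-- The Hilbert space tensor product: the completion of the algebraic tensor product for the
inner product with `⟪x ⊗ y, x' ⊗ y'⟫ = ⟪x, x'⟫ ⟪y, y'⟫`. -/
def HilbertTensor : Type _ := UniformSpace.Completion (H ⊗[ℂ] K)

noncomputable instance : NormedAddCommGroup (HilbertTensor H K) :=
  inferInstanceAs (NormedAddCommGroup (UniformSpace.Completion (H ⊗[ℂ] K)))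

noncomputable instance : InnerProductSpace ℂ (HilbertTensor H K) :=
  inferInstanceAs (InnerProductSpace ℂ (UniformSpace.Completion (H ⊗[ℂ] K)))

instance : CompleteSpace (HilbertTensor H K) :=
  inferInstanceAs (CompleteSpace (UniformSpace.Completion (H ⊗[ℂ] K)))

namespace HilbertTensor

variable {H K}

/-- The embedding of the algebraic tensor product. -/
noncomputable def ofAlg : H ⊗[ℂ] K →ₗᵢ[ℂ] HilbertTensor H K :=
  (UniformSpace.Completion.toComplₗᵢ : H ⊗[ℂ] K →ₗᵢ[ℂ] UniformSpace.Completion (H ⊗[ℂ] K))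

theorem denseRange_ofAlg : DenseRange (ofAlg : H ⊗[ℂ] K → HilbertTensor H K) :=
  UniformSpace.Completion.denseRange_coe

/-- The elementary tensor `x ⊗ y`. -/
noncomputable def tmul (x : H) (y : K) : HilbertTensor H K := ofAlg (x ⊗ₜ[ℂ] y)

theorem inner_tmul (x x' : H) (y y' : K) :
    inner ℂ (tmul x y) (tmul x' y') = inner ℂ x x' * inner ℂ y y' := by
  simp [tmul]

theorem norm_tmul (x : H) (y : K) : ‖tmul x y‖ = ‖x‖ * ‖y‖ := by
  simp [tmul]

variable (H K) in
/-- The elementary tensor as a continuous bilinear map. -/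
noncomputable def tmulL : H →L[ℂ] K →L[ℂ] HilbertTensor H K :=
  LinearMap.mkContinuous₂ ((TensorProduct.mk ℂ H K).compr₂ ofAlg.toLinearMap) 1
    (fun x y => by simp)

@[simp] theorem tmulL_apply (x : H) (y : K) : tmulL H K x y = tmul x y := rfl

theorem isTotalSet_tmul {S : Set H} {T : Set K} (hS : IsTotalSet S) (hT : IsTotalSet T) :
    IsTotalSet (Set.image2 (tmul : H → K → HilbertTensor H K) S T) := by
  set W := (Submodule.span ℂ (Set.image2 (tmul : H → K → HilbertTensor H K) S T)).topologicalClosure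
    with hW
  have hc : IsClosed (W : Set (HilbertTensor H K)) := Submodule.isClosed_topologicalClosure _
  have h0 : ∀ x ∈ S, ∀ y ∈ T, tmul x y ∈ W := fun x hx y hy =>
    Submodule.le_topologicalClosure _ (Submodule.subset_span ⟨x, hx, y, hy, rfl⟩)
  have h1 : ∀ x, ∀ y ∈ T, tmul x y ∈ W := fun x y hy =>
    hS.mem_of_isClosed (W.comap ((tmulL H K).flip y).toLinearMap)
      (hc.preimage ((tmulL H K).flip y).continuous) (fun x hx => h0 x hx y hy) x
  have h2 : ∀ x y, tmul x y ∈ W := fun x y =>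
    hT.mem_of_isClosed (W.comap (tmulL H K x).toLinearMap)
      (hc.preimage (tmulL H K x).continuous) (fun y hy => h1 x y hy) y
  have h3 : ∀ z : H ⊗[ℂ] K, ofAlg z ∈ W := by
    intro z
    induction z using TensorProduct.induction_on with
    | zero => simp
    | tmul x y => exact h2 x y
    | add a b ha hb => rw [map_add]; exact W.add_mem ha hb
  rw [IsTotalSet, ← hW, eq_top_iff]
  intro z _
  exact denseRange_ofAlg.induction_on (p := fun z => z ∈ W) z hc h3

theorem isTotalSet_univ {X : Type*} [NormedAddCommGroup X] [InnerProductSpace ℂ X] :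
    IsTotalSet (Set.univ : Set X) := by
  rw [IsTotalSet, Submodule.span_univ]
  exact eq_top_iff.mpr (Submodule.le_topologicalClosure _)

/-- To prove a closed additive property, it is enough to check elementary tensors. -/
theorem induction_on {p : HilbertTensor H K → Prop} (hc : IsClosed {z | p z})
    (ht : ∀ x y, p (tmul x y)) (ha : ∀ z w, p z → p w → p (z + w)) (z : HilbertTensor H K) :
    p z := by
  refine denseRange_ofAlg.induction_on z hc fun z => ?_
  induction z using TensorProduct.induction_on with
  | zero => simpa [tmul] using ht 0 0
  | tmul x y => exact ht x y
  | add a b h1 h2 => rw [map_add]; exact ha _ _ h1 h2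

end HilbertTensor

end HilbertTensor

open HilbertTensor in
/-- An Arveson system: a measurable family of separable Hilbert spaces `fiber t`, `t ≥ 0`, with a
measurable associative family of unitaries `V_{s,t} : fiber s ⊗ fiber t → fiber (s + t)`.

To avoid casts between `fiber (r + (s + t))` and `fiber (r + s + t)`, the unitary `V_{s,t}` is
written `V h` with target `fiber r`, where `h : s + t = r`.

The measurable structure is given by a fundamental sequence of sections: the sequence is
pointwise total (so the fibers are separable) and has measurable inner products. A section is
measurable if its inner products with the fundamental sequence are measurable. -/
structure ArvesonSystem : Type (u + 1) where
  fiber : ℝ≥0 → Type u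
  [instNormed : ∀ t, NormedAddCommGroup (fiber t)]
  [instInner : ∀ t, InnerProductSpace ℂ (fiber t)]
  [instComplete : ∀ t, CompleteSpace (fiber t)]
  fund : ℕ → ∀ t, fiber t
  isTotalSet_fund : ∀ t, IsTotalSet (Set.range fun i => fund i t)
  measurable_fund : ∀ i j, Measurable fun t => (inner ℂ (fund i t) (fund j t) : ℂ)
  V : ∀ {s t r : ℝ≥0}, s + t = r → HilbertTensor (fiber s) (fiber t) ≃ₗᵢ[ℂ] fiber r
  /-- `V_{r,s+t} ∘ (1 ⊗ V_{s,t}) = V_{r+s,t} ∘ (V_{r,s} ⊗ 1)` on the total set of elementary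
  tensors. -/
  assoc : ∀ {r s t rs st rst : ℝ≥0} (h₁ : r + s = rs) (h₂ : rs + t = rst) (h₃ : s + t = st)
    (h₄ : r + st = rst) (x : fiber r) (y : fiber s) (z : fiber t),
    V h₄ (tmul x (V h₃ (tmul y z))) = V h₂ (tmul (V h₁ (tmul x y)) z)
  measurable_V : ∀ i j k, Measurable fun p : ℝ≥0 × ℝ≥0 =>
    (inner ℂ (fund k (p.1 + p.2)) (V (rfl : p.1 + p.2 = p.1 + p.2)
      (tmul (fund i p.1) (fund j p.2))) : ℂ)

attribute [instance] ArvesonSystem.instNormed ArvesonSystem.instInner ArvesonSystem.instComplete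

namespace ArvesonSystem

open HilbertTensor

variable (E : ArvesonSystem.{u}) (F : ArvesonSystem.{v})

instance (t : ℝ≥0) : TopologicalSpace.SeparableSpace (E.fiber t) := by
  have h := (Set.countable_range fun i => E.fund i t).isSeparable.span (R := ℂ)
  have h2 := h.closure
  rw [(E.isTotalSet_fund t).dense.closure_eq] at h2
  exact TopologicalSpace.isSeparable_univ_iff.mp h2

/-- The product `V_{s,t} (x ⊗ y)`, where `s + t = r`. -/
noncomputable def mul {s t r : ℝ≥0} (h : s + t = r) (x : E.fiber s) (y : E.fiber t) :
    E.fiber r :=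
  E.V h (tmul x y)

/-- The product as a continuous bilinear map. -/
noncomputable def mulL {s t r : ℝ≥0} (h : s + t = r) :
    E.fiber s →L[ℂ] E.fiber t →L[ℂ] E.fiber r :=
  LinearMap.mkContinuous₂
    ((tmulL (E.fiber s) (E.fiber t)).toLinearMap₁₂.compr₂ (E.V h).toLinearEquiv.toLinearMap) 1
    (fun x y => by simp [norm_tmul])

@[simp] theorem mulL_apply {s t r : ℝ≥0} (h : s + t = r) (x : E.fiber s) (y : E.fiber t) :
    E.mulL h x y = E.mul h x y := rfl

theorem inner_mul {s t r : ℝ≥0} (h : s + t = r) (x x' : E.fiber s) (y y' : E.fiber t) :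
    inner ℂ (E.mul h x y) (E.mul h x' y') = inner ℂ x x' * inner ℂ y y' := by
  simp [mul, inner_tmul]

theorem mul_assoc {r s t rs st rst : ℝ≥0} (h₁ : r + s = rs) (h₂ : rs + t = rst) (h₃ : s + t = st)
    (h₄ : r + st = rst) (x : E.fiber r) (y : E.fiber s) (z : E.fiber t) :
    E.mul h₄ x (E.mul h₃ y z) = E.mul h₂ (E.mul h₁ x y) z :=
  E.assoc h₁ h₂ h₃ h₄ x y z

theorem isTotalSet_mul {s t r : ℝ≥0} (h : s + t = r) {S : Set (E.fiber s)} {T : Set (E.fiber t)}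
    (hS : IsTotalSet S) (hT : IsTotalSet T) : IsTotalSet (Set.image2 (E.mul h) S T) := by
  rw [isTotalSet_iff]
  intro x hx
  have h1 : (E.V h).symm x = 0 := by
    refine isTotalSet_iff.mp (isTotalSet_tmul hS hT) _ ?_
    rintro _ ⟨a, ha, b, hb, rfl⟩
    rw [← (E.V h).inner_map_map, LinearIsometryEquiv.apply_symm_apply]
    exact hx _ ⟨a, ha, b, hb, rfl⟩
  simpa using h1

/-! ### The tensor product of Arveson systems -/

section Tensor

variable {s t r : ℝ≥0}

/-- The unitary `(E_s ⊗ F_s) ⊗ (E_t ⊗ F_t) → E_r ⊗ F_r`, `r = s + t`, which maps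
`(x ⊗ y) ⊗ (x' ⊗ y')` to `x x' ⊗ y y'`. -/
noncomputable def tensorV (h : s + t = r) :
    HilbertTensor (HilbertTensor (E.fiber s) (F.fiber s)) (HilbertTensor (E.fiber t) (F.fiber t))
      ≃ₗᵢ[ℂ] HilbertTensor (E.fiber r) (F.fiber r) :=
  unitaryOfGram
    (fun q : (E.fiber s × F.fiber s) × (E.fiber t × F.fiber t) =>
      tmul (tmul q.1.1 q.1.2) (tmul q.2.1 q.2.2))
    (fun q => tmul (E.mul h q.1.1 q.2.1) (F.mul h q.1.2 q.2.2))
    (by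
      convert isTotalSet_tmul
        (isTotalSet_tmul (isTotalSet_univ (X := E.fiber s)) (isTotalSet_univ (X := F.fiber s)))
        (isTotalSet_tmul (isTotalSet_univ (X := E.fiber t)) (isTotalSet_univ (X := F.fiber t)))
        using 1
      ext z
      simp [Set.mem_image2])
    (by
      convert isTotalSet_tmul
        (E.isTotalSet_mul h (isTotalSet_univ (X := E.fiber s)) (isTotalSet_univ (X := E.fiber t)))
        (F.isTotalSet_mul h (isTotalSet_univ (X := F.fiber s)) (isTotalSet_univ (X := F.fiber t)))
        using 1
      ext z
      simp only [Set.mem_range, Prod.exists, Set.mem_image2, Set.mem_univ, true_and]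
      constructor
      · rintro ⟨a, b, c, d, rfl⟩
        exact ⟨_, ⟨a, c, rfl⟩, _, ⟨b, d, rfl⟩, rfl⟩
      · rintro ⟨_, ⟨a, c, rfl⟩, _, ⟨b, d, rfl⟩, rfl⟩
        exact ⟨a, b, c, d, rfl⟩)
    (by
      intro p q
      simp only [inner_tmul, inner_mul]
      ring)

theorem tensorV_tmul (h : s + t = r) (x : E.fiber s) (y : F.fiber s) (x' : E.fiber t)
    (y' : F.fiber t) :
    tensorV E F h (tmul (tmul x y) (tmul x' y')) = tmul (E.mul h x x') (F.mul h y y') :=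
  unitaryOfGram_apply
    (fun q : (E.fiber s × F.fiber s) × (E.fiber t × F.fiber t) =>
      tmul (tmul q.1.1 q.1.2) (tmul q.2.1 q.2.2))
    (fun q => tmul (E.mul h q.1.1 q.2.1) (F.mul h q.1.2 q.2.2)) _ _ _ ((x, y), (x', y'))

theorem tensorV_assoc {r s t rs st rst : ℝ≥0} (h₁ : r + s = rs) (h₂ : rs + t = rst)
    (h₃ : s + t = st) (h₄ : r + st = rst) (x : HilbertTensor (E.fiber r) (F.fiber r))
    (y : HilbertTensor (E.fiber s) (F.fiber s)) (z : HilbertTensor (E.fiber t) (F.fiber t)) :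
    tensorV E F h₄ (tmul x (tensorV E F h₃ (tmul y z)))
      = tensorV E F h₂ (tmul (tensorV E F h₁ (tmul x y)) z) := by
  simp only [← tmulL_apply]
  induction x using HilbertTensor.induction_on with
  | hc => exact isClosed_eq (by fun_prop) (by fun_prop)
  | ha a b ha hb => simp only [map_add, add_apply, ha, hb]
  | ht x x' =>
    induction y using HilbertTensor.induction_on with
    | hc => exact isClosed_eq (by fun_prop) (by fun_prop)
    | ha a b ha hb => simp only [map_add, add_apply, ha, hb]
    | ht y y' =>
      induction z using HilbertTensor.induction_on with
      | hc => exact isClosed_eq (by fun_prop) (by fun_prop)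
      | ha a b ha hb => simp only [map_add, ha, hb]
      | ht z z' =>
        simp only [tmulL_apply, tensorV_tmul]
        rw [E.mul_assoc h₁ h₂ h₃ h₄, F.mul_assoc h₁ h₂ h₃ h₄]

/-- The tensor product `(E_t ⊗ F_t)_t` of two Arveson systems. -/
noncomputable def tensor : ArvesonSystem.{max u v} where
  fiber t := HilbertTensor (E.fiber t) (F.fiber t)
  fund n t := tmul (E.fund n.unpair.1 t) (F.fund n.unpair.2 t)
  isTotalSet_fund t := by
    convert isTotalSet_tmul (E.isTotalSet_fund t) (F.isTotalSet_fund t) using 1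
    ext z
    simp only [Set.mem_range, Set.mem_image2]
    constructor
    · rintro ⟨n, rfl⟩
      exact ⟨_, ⟨_, rfl⟩, _, ⟨_, rfl⟩, rfl⟩
    · rintro ⟨_, ⟨i, rfl⟩, _, ⟨j, rfl⟩, rfl⟩
      exact ⟨Nat.pair i j, by simp⟩
  measurable_fund i j := by
    simp only [inner_tmul]
    exact (E.measurable_fund _ _).mul (F.measurable_fund _ _)
  V h := tensorV E F h
  assoc h₁ h₂ h₃ h₄ x y z := tensorV_assoc E F h₁ h₂ h₃ h₄ x y z
  measurable_V i j k := by
    simp only [tensorV_tmul, inner_tmul]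
    exact (E.measurable_V _ _ _).mul (F.measurable_V _ _ _)

/-- The elementary tensor `x ⊗ y ∈ (E ⊗ F)_t`. -/
noncomputable def tensorMk (t : ℝ≥0) : E.fiber t →L[ℂ] F.fiber t →L[ℂ] (E.tensor F).fiber t :=
  tmulL (E.fiber t) (F.fiber t)

theorem inner_tensorMk (t : ℝ≥0) (x x' : E.fiber t) (y y' : F.fiber t) :
    inner ℂ (tensorMk E F t x y) (tensorMk E F t x' y') = inner ℂ x x' * inner ℂ y y' :=
  inner_tmul x x' y y'

theorem norm_tensorMk (t : ℝ≥0) (x : E.fiber t) (y : F.fiber t) :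
    ‖tensorMk E F t x y‖ = ‖x‖ * ‖y‖ :=
  norm_tmul x y

theorem mul_tensorMk (h : s + t = r) (x : E.fiber s) (y : F.fiber s) (x' : E.fiber t)
    (y' : F.fiber t) :
    (E.tensor F).mul h (tensorMk E F s x y) (tensorMk E F t x' y')
      = tensorMk E F r (E.mul h x x') (F.mul h y y') :=
  tensorV_tmul E F h x y x' y'

end Tensor

/-! ### The lattice of product subsystems -/

/-- A product subsystem of `E`: closed subspaces `H_t ⊆ E_t` such that `V_{s,t}` maps
`H_s ⊗ H_t`, the closed span of the elementary tensors, onto `H_{s+t}`. -/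
structure Subsystem where
  space : ∀ t, Submodule ℂ (E.fiber t)
  isClosed : ∀ t, IsClosed (space t : Set (E.fiber t))
  mul_eq : ∀ {s t r : ℝ≥0} (h : s + t = r),
    (Submodule.span ℂ (Set.image2 (E.mul h) (space s : Set (E.fiber s))
      (space t : Set (E.fiber t)))).topologicalClosure = space r

variable {E F}

namespace Subsystem

@[ext] theorem ext {A B : E.Subsystem} (h : ∀ t, A.space t = B.space t) : A = B := by
  cases A; cases B
  obtain rfl := funext h
  rfl

/-- Subsystems are ordered by inclusion. -/
instance : PartialOrder E.Subsystem :=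
  PartialOrder.lift space (fun _ _ h => ext (congrFun h))

theorem le_def {A B : E.Subsystem} : A ≤ B ↔ ∀ t, A.space t ≤ B.space t := Iff.rfl

theorem mul_mem (A : E.Subsystem) {s t r : ℝ≥0} (h : s + t = r) {x : E.fiber s} {y : E.fiber t}
    (hx : x ∈ A.space s) (hy : y ∈ A.space t) : E.mul h x y ∈ A.space r := by
  rw [← A.mul_eq h]
  exact Submodule.le_topologicalClosure _ (Submodule.subset_span ⟨x, hx, y, hy, rfl⟩)

theorem adjoint_right_mem (A : E.Subsystem) {s t r : ℝ≥0} (h : s + t = r) (y : E.fiber t)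
    {x : E.fiber r} (hx : x ∈ A.space r) :
    ContinuousLinearMap.adjoint ((E.mulL h).flip y) x ∈ A.space s := by
  set T := ContinuousLinearMap.adjoint ((E.mulL h).flip y)
  have h1 : (Submodule.span ℂ (Set.image2 (E.mul h) (A.space s : Set (E.fiber s))
      (A.space t : Set (E.fiber t)))).topologicalClosure ≤ (A.space s).comap T.toLinearMap := by
    refine Submodule.topologicalClosure_minimal _ (Submodule.span_le.mpr ?_)
      ((A.isClosed s).preimage T.continuous)
    rintro _ ⟨a, ha, b, hb, rfl⟩
    have h2 : T (E.mul h a b) = (inner ℂ y b : ℂ) • a := by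
      refine ext_inner_left ℂ fun e => ?_
      rw [ContinuousLinearMap.adjoint_inner_right, inner_smul_right, mul_comm]
      exact E.inner_mul h e a y b
    change T (E.mul h a b) ∈ A.space s
    rw [h2]
    exact (A.space s).smul_mem _ ha
  rw [A.mul_eq h] at h1
  exact h1 hx

theorem adjoint_left_mem (A : E.Subsystem) {s t r : ℝ≥0} (h : s + t = r) (y : E.fiber s)
    {x : E.fiber r} (hx : x ∈ A.space r) :
    ContinuousLinearMap.adjoint (E.mulL h y) x ∈ A.space t := by
  set T := ContinuousLinearMap.adjoint (E.mulL h y)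
  have h1 : (Submodule.span ℂ (Set.image2 (E.mul h) (A.space s : Set (E.fiber s))
      (A.space t : Set (E.fiber t)))).topologicalClosure ≤ (A.space t).comap T.toLinearMap := by
    refine Submodule.topologicalClosure_minimal _ (Submodule.span_le.mpr ?_)
      ((A.isClosed t).preimage T.continuous)
    rintro _ ⟨a, ha, b, hb, rfl⟩
    have h2 : T (E.mul h a b) = (inner ℂ y a : ℂ) • b := by
      refine ext_inner_left ℂ fun e => ?_
      rw [ContinuousLinearMap.adjoint_inner_right, inner_smul_right]
      exact E.inner_mul h y a e b
    change T (E.mul h a b) ∈ A.space t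
    rw [h2]
    exact (A.space t).smul_mem _ hb
  rw [A.mul_eq h] at h1
  exact h1 hx

/-- The pointwise intersection of subsystems is a subsystem. -/
instance : InfSet E.Subsystem where
  sInf 𝒮 :=
    { space := fun t => ⨅ A ∈ 𝒮, A.space t
      isClosed := fun t => by
        simp only [Submodule.coe_iInf]
        exact isClosed_iInter fun A => isClosed_iInter fun _ => A.isClosed t
      mul_eq := by
        intro s t r h
        have hcl : ∀ t, IsClosed ((⨅ A ∈ 𝒮, A.space t : Submodule ℂ (E.fiber t)) :
            Set (E.fiber t)) := fun t => by
          simp only [Submodule.coe_iInf]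
          exact isClosed_iInter fun A => isClosed_iInter fun _ => A.isClosed t
        set P := ⨅ A ∈ 𝒮, A.space s with hP
        set Q := ⨅ A ∈ 𝒮, A.space t with hQ
        set R := ⨅ A ∈ 𝒮, A.space r with hR
        set M := (Submodule.span ℂ (Set.image2 (E.mul h) (P : Set (E.fiber s))
          (Q : Set (E.fiber t)))).topologicalClosure with hM
        have hMR : M ≤ R := by
          refine Submodule.topologicalClosure_minimal _ (Submodule.span_le.mpr ?_) (hcl r)
          rintro _ ⟨a, ha, b, hb, rfl⟩
          simp only [hP, hQ, hR, SetLike.mem_coe, Submodule.mem_iInf] at ha hb ⊢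
          exact fun A hA => A.mul_mem h (ha A hA) (hb A hA)
        refine le_antisymm hMR fun x hx => ?_
        have : CompleteSpace M := (Submodule.isClosed_topologicalClosure _).completeSpace_coe
        have : CompleteSpace P := (hcl s).completeSpace_coe
        have : CompleteSpace Q := (hcl t).completeSpace_coe
        set x' : E.fiber r := x - M.starProjection x with hx'
        have hMx : M.starProjection x ∈ M := Submodule.starProjection_apply_mem _ _
        have hx'R : x' ∈ R := R.sub_mem hx (hMR hMx)
        have hperp : ∀ m ∈ M, inner ℂ m x' = 0 := by
          have := Submodule.sub_starProjection_mem_orthogonal (K := M) x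
          exact fun m hm => (Submodule.mem_orthogonal _ _).mp this m hm
        have hl : ∀ b, ContinuousLinearMap.adjoint ((E.mulL h).flip b) x' ∈ P := by
          intro b
          simp only [hP, hR, Submodule.mem_iInf] at hx'R ⊢
          exact fun A hA => A.adjoint_right_mem h b (hx'R A hA)
        have hr : ∀ a, ContinuousLinearMap.adjoint (E.mulL h a) x' ∈ Q := by
          intro a
          simp only [hQ, hR, Submodule.mem_iInf] at hx'R ⊢
          exact fun A hA => A.adjoint_left_mem h a (hx'R A hA)
        have e1 : ∀ a ∈ Pᗮ, ∀ b, inner ℂ (E.mul h a b) x' = 0 := by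
          intro a ha b
          have := (Submodule.mem_orthogonal' _ _).mp ha _ (hl b)
          rwa [ContinuousLinearMap.adjoint_inner_right] at this
        have e2 : ∀ a, ∀ b ∈ Qᗮ, inner ℂ (E.mul h a b) x' = 0 := by
          intro a b hb
          have := (Submodule.mem_orthogonal' _ _).mp hb _ (hr a)
          rwa [ContinuousLinearMap.adjoint_inner_right] at this
        have e3 : ∀ a ∈ P, ∀ b ∈ Q, inner ℂ (E.mul h a b) x' = 0 := fun a ha b hb =>
          hperp _ (Submodule.le_topologicalClosure _ (Submodule.subset_span ⟨a, ha, b, hb, rfl⟩))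
        have hzero : x' = 0 := by
          refine isTotalSet_iff.mp (E.isTotalSet_mul h isTotalSet_univ isTotalSet_univ) _ ?_
          rintro _ ⟨a, -, b, -, rfl⟩
          obtain ⟨a1, ha1, a2, ha2, rfl⟩ := P.exists_add_mem_mem_orthogonal a
          obtain ⟨b1, hb1, b2, hb2, rfl⟩ := Q.exists_add_mem_mem_orthogonal b
          have h1 := e1 a2 ha2 (b1 + b2)
          have h2 := e2 a1 b2 hb2
          have h3 := e3 a1 ha1 b1 hb1
          simp only [← mulL_apply, map_add, add_apply, inner_add_left]
            at h1 h2 h3 ⊢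
          rw [h3, h2]
          simpa using h1
        rw [sub_eq_zero.mp (hx'.symm.trans hzero)]
        exact hMx }

theorem space_sInf (𝒮 : Set E.Subsystem) (t : ℝ≥0) :
    (sInf 𝒮).space t = ⨅ A ∈ 𝒮, A.space t := rfl

/-- The whole system, as a subsystem of itself. -/
def full : E.Subsystem where
  space _ := ⊤
  isClosed _ := isClosed_univ
  mul_eq h := by
    simpa [IsTotalSet] using E.isTotalSet_mul h isTotalSet_univ isTotalSet_univ

/-- The product subsystems of an Arveson system form a complete lattice: the meet is the pointwise
intersection, the join `A ⊔ B` is the smallest subsystem that contains `A` and `B`, and the top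
element is the whole system. -/
instance : CompleteLattice E.Subsystem :=
  { completeLatticeOfInf E.Subsystem (fun _ =>
      ⟨fun A hA _ => iInf₂_le A hA, fun _ hB t => le_iInf₂ fun _ hA => hB hA t⟩) with
    top := full
    le_top := fun _ _ => le_top }

@[simp] theorem space_top (t : ℝ≥0) : (⊤ : E.Subsystem).space t = ⊤ := rfl

end Subsystem

/-! ### Units, type I systems and the spatial product -/

variable (E) in
/-- A unit: a measurable section of non-zero vectors with `u_{s+t} = u_s ⊗ u_t`. -/
structure IsUnitSection (x : ∀ t, E.fiber t) : Prop where
  measurable : ∀ i, Measurable fun t => (inner ℂ (E.fund i t) (x t) : ℂ)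
  ne_zero : ∀ t, x t ≠ 0
  mul : ∀ {s t r : ℝ≥0} (h : s + t = r), E.mul h (x s) (x t) = x r

variable (E) in
/-- A unital unit of `E`; a spatial Arveson system is a pair of an Arveson system and a unital
unit of it. -/
structure UnitalUnit where
  sec : ∀ t, E.fiber t
  isUnitSection : E.IsUnitSection sec
  norm_sec : ∀ t, ‖sec t‖ = 1

variable (E) in
/-- The subsystem `E⁰` generated by all units of `E`. -/
noncomputable def unitSubsystem : E.Subsystem :=
  sInf {A | ∀ x, E.IsUnitSection x → ∀ t, x t ∈ A.space t}

variable (E) in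
/-- `E` is of type I if it is generated by its units. -/
def IsTypeI : Prop := E.unitSubsystem = ⊤

/-- The subsystem `u ⊗ F` of `E ⊗ F`, with fibers `u_t ⊗ F_t`. -/
noncomputable def unitTensor (x : E.UnitalUnit) (F : ArvesonSystem.{v}) :
    (E.tensor F).Subsystem where
  space t := LinearMap.range (tensorMk E F t (x.sec t)).toLinearMap
  isClosed t := by
    have h : Isometry (tensorMk E F t (x.sec t)) :=
      AddMonoidHomClass.isometry_of_norm _ fun y => by simp [norm_tensorMk, x.norm_sec]
    exact h.isClosedEmbedding.isClosed_range
  mul_eq := by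
    intro s t r h
    have hiso : Isometry (tensorMk E F r (x.sec r)) :=
      AddMonoidHomClass.isometry_of_norm _ fun y => by simp [norm_tensorMk, x.norm_sec]
    apply le_antisymm
    · refine Submodule.topologicalClosure_minimal _ (Submodule.span_le.mpr ?_)
        hiso.isClosedEmbedding.isClosed_range
      rintro _ ⟨_, ⟨a, rfl⟩, _, ⟨b, rfl⟩, rfl⟩
      refine ⟨F.mul h a b, ?_⟩
      have := mul_tensorMk E F h (x.sec s) a (x.sec t) b
      rw [x.isUnitSection.mul h] at this
      exact this.symm
    · rintro _ ⟨z, rfl⟩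
      refine (F.isTotalSet_mul h isTotalSet_univ isTotalSet_univ).mem_of_isClosed
        (Submodule.comap (tensorMk E F r (x.sec r)).toLinearMap (Submodule.topologicalClosure _))
        ((Submodule.isClosed_topologicalClosure _).preimage
          (tensorMk E F r (x.sec r)).continuous) ?_ z
      rintro _ ⟨a, -, b, -, rfl⟩
      refine Submodule.le_topologicalClosure _ (Submodule.subset_span
        ⟨_, ⟨a, rfl⟩, _, ⟨b, rfl⟩, ?_⟩)
      have := mul_tensorMk E F h (x.sec s) a (x.sec t) b
      rw [x.isUnitSection.mul h] at this
      exact this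

/-- The subsystem `E ⊗ v` of `E ⊗ F`, with fibers `E_t ⊗ v_t`. -/
noncomputable def tensorUnit (E : ArvesonSystem.{u}) (y : F.UnitalUnit) :
    (E.tensor F).Subsystem where
  space t := LinearMap.range ((tensorMk E F t).flip (y.sec t)).toLinearMap
  isClosed t := by
    have h : Isometry ((tensorMk E F t).flip (y.sec t)) :=
      AddMonoidHomClass.isometry_of_norm _ fun x => by simp [norm_tensorMk, y.norm_sec]
    exact h.isClosedEmbedding.isClosed_range
  mul_eq := by
    intro s t r h
    have hiso : Isometry ((tensorMk E F r).flip (y.sec r)) :=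
      AddMonoidHomClass.isometry_of_norm _ fun x => by simp [norm_tensorMk, y.norm_sec]
    apply le_antisymm
    · refine Submodule.topologicalClosure_minimal _ (Submodule.span_le.mpr ?_)
        hiso.isClosedEmbedding.isClosed_range
      rintro _ ⟨_, ⟨a, rfl⟩, _, ⟨b, rfl⟩, rfl⟩
      refine ⟨E.mul h a b, ?_⟩
      have := mul_tensorMk E F h a (y.sec s) b (y.sec t)
      rw [y.isUnitSection.mul h] at this
      exact this.symm
    · rintro _ ⟨z, rfl⟩
      refine (E.isTotalSet_mul h isTotalSet_univ isTotalSet_univ).mem_of_isClosed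
        (Submodule.comap ((tensorMk E F r).flip (y.sec r)).toLinearMap
          (Submodule.topologicalClosure _))
        ((Submodule.isClosed_topologicalClosure _).preimage
          ((tensorMk E F r).flip (y.sec r)).continuous) ?_ z
      rintro _ ⟨a, -, b, -, rfl⟩
      refine Submodule.le_topologicalClosure _ (Submodule.subset_span
        ⟨_, ⟨a, rfl⟩, _, ⟨b, rfl⟩, ?_⟩)
      have := mul_tensorMk E F h a (y.sec s) b (y.sec t)
      rw [y.isUnitSection.mul h] at this
      exact this

/-- The spatial product of the spatial Arveson systems `(E, x)` and `(F, y)`: the smallest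
subsystem of `E ⊗ F` that contains `x ⊗ F` and `E ⊗ y`. -/
noncomputable def spatialProduct (x : E.UnitalUnit) (y : F.UnitalUnit) :
    (E.tensor F).Subsystem :=
  unitTensor x F ⊔ tensorUnit E y

end ArvesonSystem

/-! Let `G` be the spatial product. The vectors `y` of `F_t` with `E_t ⊗ y ⊆ G_t` form a product
subsystem of `F`, the slice of `G`. By type I it is all of `F` as soon as it contains every unit, so
the heart is `tensorMk_unital_mem`: if `G` contains `u ⊗ F` and `E ⊗ v`, then it contains `x ⊗ w_t`
for every unit `w` of `F`.

Put `z = x ⊗ w_t` and let `f s` be the squared distance of `z` from the vectors that lie in `G` up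
to time `s` and are free afterwards (`headSpace`). Then `f 0 = 0`, and `f t = 0` means `z ∈ G_t`.
Passing from `s` to `s + d` costs at most the squared distance of `z` from the vectors that lie in
`G` during `[s, s + d]` only (`middleSpace`). These include `p ⊗ w_t`, with `u_d` inserted in `p`
there, and `x' ⊗ ω`, with `v_d` replacing `w_d` in `w_t`. Combining both leaves an error `(x - p) ⊗
(w_t - ⟪ω, w_t⟫ ω)`, of squared norm `‖x - p‖² (1 - |⟪v_d, w_d⟫|²)`. The second factor is `O(d)`
(`exists_one_sub_norm_inner_sq_le`) and the first can be made arbitrarily small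
(`exists_mem_insertSpan`). The cost is thus `o(d)` along small `d`, and a continuous function with
such right slopes does not grow.

Both estimates rest on separability: among the uncountably many vectors `e_s b e_{1-s}` two are
close, so `b` almost commutes with some `e_d` (`exists_norm_mul_sub_mul_lt`), hence is almost
divisible by it. -/

/-- A map from an uncountable type to a separable metric space takes two arbitrarily close
values. -/
theorem exists_ne_dist_lt {α Z : Type*} [Uncountable α] [PseudoMetricSpace Z]
    [TopologicalSpace.SeparableSpace Z] (g : α → Z) {ε : ℝ} (hε : 0 < ε) :
    ∃ a b, a ≠ b ∧ dist (g a) (g b) < ε := by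
  have : Nonempty Z := (inferInstance : Nonempty α).map g
  obtain ⟨d, hd⟩ := TopologicalSpace.exists_dense_seq Z
  choose i hi using fun a => hd.exists_dist_lt (g a) (half_pos hε)
  have hni : ¬ Function.Injective i := fun h => not_countable (α := α) h.countable
  simp only [Function.Injective, not_forall] at hni
  obtain ⟨a, b, hab, hne⟩ := hni
  refine ⟨a, b, hne, ?_⟩
  have h2 := hi b
  rw [← hab, dist_comm] at h2
  linarith [dist_triangle (g a) (d (i a)) (g b), hi a]

namespace ArvesonSystem

open HilbertTensor

variable {E : ArvesonSystem.{u}} {F : ArvesonSystem.{v}}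

/-! ### Products and their slices in one system -/

theorem norm_mul {s t r : ℝ≥0} (h : s + t = r) (x : E.fiber s) (y : E.fiber t) :
    ‖E.mul h x y‖ = ‖x‖ * ‖y‖ := by
  simp [mul, norm_tmul]

theorem mul_sub {s t r : ℝ≥0} (h : s + t = r) (x : E.fiber s) (y y' : E.fiber t) :
    E.mul h x (y - y') = E.mul h x y - E.mul h x y' :=
  map_sub (E.mulL h x) y y'

theorem sub_mul {s t r : ℝ≥0} (h : s + t = r) (x x' : E.fiber s) (y : E.fiber t) :
    E.mul h (x - x') y = E.mul h x y - E.mul h x' y :=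
  map_sub ((E.mulL h).flip y) x x'

/-- To prove that all vectors of a fiber lie in a closed subspace, it is enough to check
products. -/
theorem mem_of_mul_mem {s t r : ℝ≥0} (h : s + t = r) (W : Submodule ℂ (E.fiber r))
    (hW : IsClosed (W : Set (E.fiber r))) (hm : ∀ x y, E.mul h x y ∈ W) (z : E.fiber r) :
    z ∈ W := by
  refine (E.isTotalSet_mul h isTotalSet_univ isTotalSet_univ).mem_of_isClosed W hW ?_ z
  rintro _ ⟨x, -, y, -, rfl⟩
  exact hm x y

/-- The adjoint of the right multiplication by `y`. -/
noncomputable def mulRightAdj {s t r : ℝ≥0} (h : s + t = r) (y : E.fiber t) :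
    E.fiber r →L[ℂ] E.fiber s :=
  ContinuousLinearMap.adjoint ((E.mulL h).flip y)

theorem mulRightAdj_mul {s t r : ℝ≥0} (h : s + t = r) (y : E.fiber t) (a : E.fiber s)
    (b : E.fiber t) : mulRightAdj h y (E.mul h a b) = (inner ℂ y b : ℂ) • a := by
  refine ext_inner_left ℂ fun e => ?_
  rw [mulRightAdj, ContinuousLinearMap.adjoint_inner_right, inner_smul_right, _root_.mul_comm]
  exact E.inner_mul h e a y b

theorem norm_mulRightAdj_le {s t r : ℝ≥0} (h : s + t = r) (y : E.fiber t) (z : E.fiber r) :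
    ‖mulRightAdj h y z‖ ≤ ‖y‖ * ‖z‖ := by
  refine (mulRightAdj h y).le_of_opNorm_le ?_ z
  rw [mulRightAdj, LinearIsometryEquiv.norm_map]
  refine ContinuousLinearMap.opNorm_le_bound _ (norm_nonneg _) fun x => ?_
  simp [norm_mul, _root_.mul_comm]

/-- Right adjoint multiplications commute with left multiplications. -/
theorem mulRightAdj_left_mul {r s t rs st rst : ℝ≥0} (h₁ : r + s = rs) (h₂ : rs + t = rst)
    (h₃ : s + t = st) (h₄ : r + st = rst) (c : E.fiber r) (y : E.fiber t) (z : E.fiber st) :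
    mulRightAdj h₂ y (E.mul h₄ c z) = E.mul h₁ c (mulRightAdj h₃ y z) := by
  refine mem_of_mul_mem h₃
    (LinearMap.eqLocus ((mulRightAdj h₂ y).comp (E.mulL h₄ c)).toLinearMap
      ((E.mulL h₁ c).comp (mulRightAdj h₃ y)).toLinearMap)
    (isClosed_eq ((mulRightAdj h₂ y).comp (E.mulL h₄ c)).continuous
      ((E.mulL h₁ c).comp (mulRightAdj h₃ y)).continuous) (fun a b => ?_) z
  change mulRightAdj h₂ y (E.mul h₄ c (E.mul h₃ a b)) = E.mul h₁ c (mulRightAdj h₃ y (E.mul h₃ a b))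
  rw [E.mul_assoc h₁ h₂ h₃ h₄, mulRightAdj_mul, mulRightAdj_mul]
  exact ((E.mulL h₁ c).map_smul _ _).symm

/-! ### Approximate division by a unit at small times -/

variable (E) in
/-- A multiplicative section of unit vectors. -/
structure IsUnitalSection (e : ∀ t, E.fiber t) : Prop where
  norm_eq : ∀ t, ‖e t‖ = 1
  mul_eq : ∀ {s t r : ℝ≥0} (h : s + t = r), E.mul h (e s) (e t) = e r

theorem UnitalUnit.isUnitalSection (x : E.UnitalUnit) : E.IsUnitalSection x.sec :=
  ⟨x.norm_sec, x.isUnitSection.mul⟩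

namespace IsUnitalSection

variable {e : ∀ t, E.fiber t}

/-- The fiber at time 0 is not assumed to be ℂ. Idempotence of `e 0` makes `e 0 · (e 0 · x - x)`
vanish, and multiplication by a unit vector is isometric. -/
theorem zero_mul (he : E.IsUnitalSection e) {t : ℝ≥0} (h : 0 + t = t) (x : E.fiber t) :
    E.mul h (e 0) x = x := by
  have h1 : E.mul h (e 0) (E.mul h (e 0) x - x) = 0 := by
    rw [mul_sub, E.mul_assoc (add_zero 0) h h h, he.mul_eq, sub_self]
  have h2 := norm_mul h (e 0) (E.mul h (e 0) x - x)
  rw [h1, he.norm_eq, norm_zero, one_mul] at h2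
  exact sub_eq_zero.mp (norm_eq_zero.mp h2.symm)

theorem mul_zero (he : E.IsUnitalSection e) {t : ℝ≥0} (h : t + 0 = t) (x : E.fiber t) :
    E.mul h x (e 0) = x := by
  have h1 : E.mul h (E.mul h x (e 0) - x) (e 0) = 0 := by
    rw [sub_mul, ← E.mul_assoc h h (add_zero 0) h, he.mul_eq, sub_self]
  have h2 := norm_mul h (E.mul h x (e 0) - x) (e 0)
  rw [h1, he.norm_eq, norm_zero, mul_one] at h2
  exact sub_eq_zero.mp (norm_eq_zero.mp h2.symm)

theorem inner_self (he : E.IsUnitalSection e) (t : ℝ≥0) : (inner ℂ (e t) (e t) : ℂ) = 1 := by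
  rw [inner_self_eq_norm_sq_to_K, he.norm_eq]; simp

/-- Slide `b` through the unit: the vectors `e_s b e_{1-s}` all lie in the separable fiber at time
`r + 1`. Two close ones share the outer factors `e_a` and `e_{1-b'}`, and cancelling these isometric
factors compares `b e_d` with `e_d b`, where `d = b' - a`. -/
theorem exists_norm_mul_sub_mul_lt (he : E.IsUnitalSection e) {r : ℝ≥0} (b : E.fiber r)
    {ε η : ℝ} (hε : 0 < ε) (hη : 0 < η) :
    ∃ d q : ℝ≥0, 0 < d ∧ (d : ℝ) < η ∧ ∃ (h : d + r = q) (h' : r + d = q),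
      ‖E.mul h (e d) b - E.mul h' b (e d)‖ < ε := by
  have : Uncountable (Set.Icc (0 : ℝ) 1) := by
    rw [← Cardinal.aleph0_lt_mk_iff, Cardinal.mk_Icc_real zero_lt_one]
    exact Cardinal.aleph0_lt_continuum
  let σ : Set.Icc (0 : ℝ) 1 → ℝ≥0 := fun s => ⟨s, s.2.1⟩
  have hσ : ∀ s, σ s ≤ 1 := fun s => s.2.2
  have hs : ∀ s, (σ s + r) + (1 - σ s) = r + 1 := fun s => by
    rw [add_right_comm, add_tsub_cancel_of_le (hσ s), add_comm]
  -- The parameter is recorded as a first coordinate so that closeness also gives `d < η`.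
  obtain ⟨a, b', hne, hlt⟩ := exists_ne_dist_lt
    (fun s : Set.Icc (0 : ℝ) 1 => ((s : ℝ), E.mul (hs s) (E.mul rfl (e (σ s)) b) (e (1 - σ s)))) (lt_min hε hη)
  wlog hab : (a : ℝ) < b' generalizing a b'
  · refine this b' a hne.symm (by rwa [dist_comm]) ?_
    exact lt_of_le_of_ne (not_lt.mp hab) fun h => hne (Subtype.ext h.symm)
  rw [Prod.dist_eq, max_lt_iff] at hlt
  obtain ⟨h1, h2⟩ := hlt
  have hab' : σ a ≤ σ b' := hab.le
  have hd : σ a + (σ b' - σ a) = σ b' := add_tsub_cancel_of_le hab'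
  have hd2 : (σ b' - σ a) + (1 - σ b') = 1 - σ a := by
    rw [add_comm, tsub_add_tsub_cancel (hσ b') hab']
  have hcoe : ((σ b' - σ a : ℝ≥0) : ℝ) = b' - a := NNReal.coe_sub hab'
  refine ⟨σ b' - σ a, r + (σ b' - σ a), ?_, ?_, add_comm _ _, rfl, ?_⟩
  · exact tsub_pos_of_lt hab
  · rw [hcoe]
    rw [Real.dist_eq, abs_sub_comm, abs_of_pos (sub_pos.mpr hab)] at h1
    exact h1.trans_le (min_le_right _ _)
  · generalize hδ : σ b' - σ a = d at hd hd2 hcoe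
    have h3 : E.mul (hs a) (E.mul rfl (e (σ a)) b) (e (1 - σ a)) =
        E.mul (show (σ a + (r + d)) + (1 - σ b') = r + 1 by rw [← hs a, ← hd2]; ring)
          (E.mul rfl (e (σ a)) (E.mul rfl b (e d))) (e (1 - σ b')) := by
      rw [← he.mul_eq hd2, E.mul_assoc (show (σ a + r) + d = σ a + (r + d) by ring) _ _ _,
        E.mul_assoc]
    have h4 : E.mul (hs b') (E.mul rfl (e (σ b')) b) (e (1 - σ b')) =
        E.mul (show (σ a + (r + d)) + (1 - σ b') = r + 1 by rw [← hs a, ← hd2]; ring)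
          (E.mul rfl (e (σ a)) (E.mul (add_comm _ _) (e d) b)) (e (1 - σ b')) := by
      rw [← he.mul_eq hd]
      have h5 : σ b' + r = σ a + (r + d) := by rw [← hd]; ring
      -- The two sides pass through fibers whose times are only propositionally equal; abstracting
      -- one time as `q` lets `rfl` identify them.
      have : ∀ {q : ℝ≥0} (h5 : σ b' + r = q) (h6 : q + (1 - σ b') = r + 1)
          (h7 : σ a + (r + d) = q),
          E.mul (hs b') (E.mul rfl (E.mul hd (e (σ a)) (e d)) b) (e (1 - σ b')) =
          E.mul h6 (E.mul h7 (e (σ a)) (E.mul (add_comm d r) (e d) b)) (e (1 - σ b')) := by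
        rintro q rfl h6 h7
        rw [E.mul_assoc hd rfl (add_comm d r) h7]
      exact this h5 _ rfl
    have h6 := h2.trans_le (min_le_left _ _)
    simp only at h6
    rw [h3, h4, dist_comm, dist_eq_norm, ← sub_mul, ← mul_sub, norm_mul, norm_mul, he.norm_eq,
      he.norm_eq, one_mul, mul_one] at h6
    exact h6

/-- Every vector is approximately divisible on the left by a unit, at small times. -/
theorem exists_norm_sub_mul_lt (he : E.IsUnitalSection e) {r : ℝ≥0} (hr : 0 < r)
    (b : E.fiber r) {ε : ℝ} (hε : 0 < ε) :
    ∃ d q : ℝ≥0, 0 < d ∧ ∃ (h : d + q = r) (b' : E.fiber q), ‖b - E.mul h (e d) b'‖ < ε := by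
  obtain ⟨d, q, hd, hdr, h, h', hlt⟩ :=
    he.exists_norm_mul_sub_mul_lt b hε (NNReal.coe_pos.mpr hr)
  have hdr' : d ≤ r := NNReal.coe_le_coe.mp hdr.le
  have h1 : d + (r - d) = r := add_tsub_cancel_of_le hdr'
  have h2 : (r - d) + d = r := tsub_add_cancel_of_le hdr'
  -- Strip `e_d` off the right of `b`. Since right slicing commutes with left multiplication, the
  -- error is the right slice of the commutator `b e_d - e_d b`.
  refine ⟨d, r - d, hd, h1, mulRightAdj h2 (e d) b, ?_⟩
  have h3 : b - E.mul h1 (e d) (mulRightAdj h2 (e d) b) =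
      mulRightAdj h' (e d) (E.mul h' b (e d) - E.mul h (e d) b) := by
    rw [map_sub, mulRightAdj_left_mul h1 h' h2 h, mulRightAdj_mul, he.inner_self, one_smul]
  rw [h3]
  refine (norm_mulRightAdj_le h' _ _).trans_lt ?_
  rwa [he.norm_eq, one_mul, norm_sub_rev]

end IsUnitalSection

/-! ### Inserting a unit, and the covariance of two units -/

/-- The span of the products `a · e_d · b ∈ E_t` with `a ∈ E_s`. -/
noncomputable def insertSpan (e : ∀ t, E.fiber t) (s d t : ℝ≥0) : Submodule ℂ (E.fiber t) :=
  Submodule.span ℂ {z | ∃ (q r : ℝ≥0) (h : s + q = t) (h' : d + r = q) (a : E.fiber s)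
    (b : E.fiber r), E.mul h a (E.mul h' (e d) b) = z}

namespace IsUnitalSection

variable {e : ∀ t, E.fiber t}

/-- A longer stretch of the unit splits as `e_d · e_{d'-d}`, and the second piece is absorbed into
the free tail. This makes the family directed as `d` decreases to 0. -/
theorem insertSpan_anti (he : E.IsUnitalSection e) (s t : ℝ≥0) {d d' : ℝ≥0} (hd : d ≤ d') :
    insertSpan e s d' t ≤ insertSpan e s d t := by
  refine Submodule.span_le.mpr ?_
  rintro _ ⟨q, r, h, h', a, b, rfl⟩
  have h1 : d + (d' - d) = d' := add_tsub_cancel_of_le hd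
  refine Submodule.subset_span ⟨q, (d' - d) + r, h, by rw [← add_assoc, h1, h'], a,
    E.mul rfl (e (d' - d)) b, ?_⟩
  rw [E.mul_assoc h1 h' rfl _, he.mul_eq]

theorem exists_mem_insertSpan (he : E.IsUnitalSection e) {s t : ℝ≥0} (hst : s < t)
    (x : E.fiber t) {ε : ℝ} (hε : 0 < ε) {η : ℝ≥0} (hη : 0 < η) :
    ∃ d, 0 < d ∧ d ≤ η ∧ ∃ p ∈ insertSpan e s d t, ‖x - p‖ < ε := by
  have hq : s + (t - s) = t := add_tsub_cancel_of_le hst.le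
  have hdir : Directed (· ≤ ·) fun d : {d : ℝ≥0 // 0 < d} => insertSpan e s d.1 t := fun a b =>
    ⟨⟨min a.1 b.1, lt_min a.2 b.2⟩, he.insertSpan_anti s t (min_le_left _ _),
      he.insertSpan_anti s t (min_le_right _ _)⟩
  have : Nonempty {d : ℝ≥0 // 0 < d} := ⟨⟨1, one_pos⟩⟩
  set W := (⨆ d : {d : ℝ≥0 // 0 < d}, insertSpan e s d.1 t).topologicalClosure with hW
  have hWc : IsClosed (W : Set (E.fiber t)) := Submodule.isClosed_topologicalClosure _
  have hx : x ∈ W := by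
    refine mem_of_mul_mem hq W hWc (fun a b => ?_) x
    have hc : IsClosed (W.comap (E.mulL hq a).toLinearMap : Set (E.fiber (t - s))) :=
      hWc.preimage (E.mulL hq a).continuous
    change b ∈ (W.comap (E.mulL hq a).toLinearMap : Set (E.fiber (t - s)))
    rw [← hc.closure_eq, Metric.mem_closure_iff]
    intro ε hε
    obtain ⟨d, r, hd, h, b', hb'⟩ := he.exists_norm_sub_mul_lt (tsub_pos_of_lt hst) b hε
    refine ⟨E.mul h (e d) b', ?_, by rwa [dist_eq_norm]⟩
    exact Submodule.le_topologicalClosure _ (Submodule.mem_iSup_of_mem ⟨d, hd⟩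
      (Submodule.subset_span ⟨_, r, hq, h, a, b', rfl⟩))
  obtain ⟨p, hp, hlt⟩ := Metric.mem_closure_iff.mp hx ε hε
  obtain ⟨d, hd⟩ := (Submodule.mem_iSup_of_directed _ hdir).mp hp
  exact ⟨min d.1 η, lt_min d.2 hη, min_le_right _ _, p,
    he.insertSpan_anti s t (min_le_left _ _) hd, by rwa [← dist_eq_norm]⟩

/-- The covariance of two unital units decays at most exponentially. -/
theorem exists_one_sub_norm_inner_sq_le {v w : ∀ t, E.fiber t} (hv : E.IsUnitalSection v)
    (hw : E.IsUnitalSection w) :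
    ∃ C : ℝ, 0 ≤ C ∧ ∀ d : ℝ≥0, 1 - ‖(inner ℂ (v d) (w d) : ℂ)‖ ^ 2 ≤ C * d := by
  set f : ℝ≥0 → ℝ := fun d => ‖(inner ℂ (v d) (w d) : ℂ)‖ ^ 2 with hf
  have hmul : ∀ s t, f (s + t) = f s * f t := fun s t => by
    simp only [hf]
    rw [← hv.mul_eq (rfl : s + t = s + t), ← hw.mul_eq (rfl : s + t = s + t), inner_mul,
      _root_.norm_mul, mul_pow]
  have hle : ∀ s, f s ≤ 1 := fun s => by
    have := norm_inner_le_norm (𝕜 := ℂ) (v s) (w s)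
    rw [hv.norm_eq, hw.norm_eq, one_mul] at this
    exact pow_le_one₀ (norm_nonneg _) this
  have hnn : ∀ s, 0 ≤ f s := fun s => sq_nonneg _
  -- The covariance is non-zero at `d₀`: otherwise `w 1 = w_{d₀} w_q` would be orthogonal to `v_{d₀}
  -- b`, hence at distance at least 1 from it.
  obtain ⟨d₀, q, hd₀, h, b, hb⟩ := hv.exists_norm_sub_mul_lt one_pos (w 1) one_pos
  have hpos : 0 < f d₀ := by
    refine (hnn d₀).lt_of_ne fun h0 => ?_
    have h1 : (inner ℂ (v d₀) (w d₀) : ℂ) = 0 := by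
      simpa [hf] using h0.symm
    have h2 : (inner ℂ (w 1) (E.mul h (v d₀) b) : ℂ) = 0 := by
      rw [← hw.mul_eq h, inner_mul, ← inner_conj_symm, h1]
      simp
    have h3 := norm_sub_sq (𝕜 := ℂ) (w 1) (E.mul h (v d₀) b)
    rw [h2, hw.norm_eq] at h3
    simp only [map_zero, MulZeroClass.mul_zero] at h3
    nlinarith [norm_nonneg (w 1 - E.mul h (v d₀) b), sq_nonneg ‖E.mul h (v d₀) b‖]
  have hanti : ∀ {s t}, s ≤ t → f t ≤ f s := fun {s t} hst => by
    rw [← add_tsub_cancel_of_le hst, hmul]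
    exact mul_le_of_le_one_right (hnn _) (hle _)
  have hpow : ∀ (n : ℕ) (d : ℝ≥0), f ((n + 1 : ℕ) * d) = f d ^ (n + 1) := fun n d => by
    induction n with
    | zero => simp
    | succ n ih => rw [pow_succ, ← ih, ← hmul]; congr 1; push_cast; ring
  have hd₀' : (0 : ℝ) < d₀ := hd₀
  set κ := -Real.log (f d₀) with hκ
  have hκ0 : 0 ≤ κ := neg_nonneg.mpr (Real.log_nonpos (hnn _) (hle _))
  -- The summand `2 * κ` serves `d ≤ d₀`; the `+ 1` serves `d > d₀`, where `1 - f d ≤ 1` suffices.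
  refine ⟨(2 * κ + 1) / d₀, by positivity, fun d => ?_⟩
  change 1 - f d ≤ _
  rw [div_mul_eq_mul_div, le_div_iff₀ hd₀']
  rcases lt_or_ge d₀ d with hlt | hge
  · have : (d₀ : ℝ) < d := hlt
    nlinarith [hnn d, hle d, d.2]
  rcases eq_or_lt_of_le (zero_le : 0 ≤ d) with rfl | hd
  · have h0 := hmul 0 d₀
    rw [zero_add] at h0
    have : f 0 = 1 := by
      have := mul_right_cancel₀ hpos.ne' (h0.symm.trans (one_mul _).symm)
      exact this
    simp [this]
  have hd' : (0 : ℝ) < d := hd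
  -- Fit `n + 1` copies of `d` into `d₀`: then `f d₀ ≤ f d ^ (n + 1)`, and `1 - f d ≤ -log (f d)`
  -- bounds `1 - f d` by `κ / (n + 1)`.
  obtain ⟨n, hn⟩ : ∃ n : ℕ, ⌊(d₀ : ℝ) / d⌋₊ = n + 1 :=
    Nat.exists_eq_succ_of_ne_zero
      (Nat.floor_pos.mpr ((one_le_div hd').mpr hge)).ne'
  have hn1 : ((n + 1 : ℕ) : ℝ) * d ≤ d₀ := by
    rw [← hn, ← le_div_iff₀ hd']
    exact Nat.floor_le (by positivity)
  have hn2 : (d₀ : ℝ) ≤ ((n + 1 : ℕ) + 1 : ℝ) * d := by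
    rw [← hn, ← div_le_iff₀ hd']
    exact (Nat.lt_floor_add_one _).le
  have hfd : 0 < f d := hpos.trans_le (hanti hge)
  have h4 : ((n + 1 : ℕ) : ℝ) * (1 - f d) ≤ κ := by
    have h5 : f d₀ ≤ f d ^ (n + 1) := by
      rw [← hpow]
      exact hanti (by exact_mod_cast hn1)
    have h6 : Real.log (f d₀) ≤ ((n + 1 : ℕ) : ℝ) * Real.log (f d) := by
      rw [← Real.log_pow]
      exact Real.log_le_log hpos h5
    have h7 := Real.log_le_sub_one_of_pos hfd
    have h8 : (0 : ℝ) ≤ ((n + 1 : ℕ) : ℝ) := Nat.cast_nonneg _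
    nlinarith
  have h9 : ((n + 1 : ℕ) + 1 : ℝ) ≤ 2 * ((n + 1 : ℕ) : ℝ) := by
    push_cast; linarith [(Nat.cast_nonneg n : (0 : ℝ) ≤ n)]
  calc (1 - f d) * d₀ ≤ (1 - f d) * (2 * ((n + 1 : ℕ) : ℝ) * d) := by
        refine mul_le_mul_of_nonneg_left (hn2.trans ?_) (sub_nonneg.mpr (hle d))
        exact mul_le_mul_of_nonneg_right h9 hd'.le
    _ = 2 * (((n + 1 : ℕ) : ℝ) * (1 - f d)) * d := by ring
    _ ≤ 2 * κ * d := by gcongr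
    _ ≤ (2 * κ + 1) * d := by gcongr; linarith

end IsUnitalSection

/-! ### Distance to the vectors that lie in a subsystem up to time `s` -/

namespace Subsystem

/-- The closed span of the products `g · b ∈ E_t` with `g` in the fiber of `G` at time `s`. -/
noncomputable def headSpace (G : E.Subsystem) (s t : ℝ≥0) : Submodule ℂ (E.fiber t) :=
  (Submodule.span ℂ {z | ∃ (q : ℝ≥0) (h : s + q = t), ∃ g ∈ G.space s, ∃ b : E.fiber q,
    E.mul h g b = z}).topologicalClosure

/-- The closed span of the products `a · g · b ∈ E_t` with `a ∈ E_s` and `g` in the fiber of `G`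
at time `d`. -/
noncomputable def middleSpace (G : E.Subsystem) (s d t : ℝ≥0) : Submodule ℂ (E.fiber t) :=
  (Submodule.span ℂ {z | ∃ (q r : ℝ≥0) (h : s + q = t) (h' : d + r = q) (a : E.fiber s),
    ∃ g ∈ G.space d, ∃ b : E.fiber r, E.mul h a (E.mul h' g b) = z}).topologicalClosure

variable (G : E.Subsystem)

theorem isClosed_headSpace (s t : ℝ≥0) : IsClosed (G.headSpace s t : Set (E.fiber t)) :=
  Submodule.isClosed_topologicalClosure _

theorem isClosed_middleSpace (s d t : ℝ≥0) : IsClosed (G.middleSpace s d t : Set (E.fiber t)) :=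
  Submodule.isClosed_topologicalClosure _

instance (s t : ℝ≥0) : CompleteSpace (G.headSpace s t) :=
  (G.isClosed_headSpace s t).completeSpace_coe

theorem mul_mem_headSpace {s q t : ℝ≥0} (h : s + q = t) {g : E.fiber s} (hg : g ∈ G.space s)
    (b : E.fiber q) : E.mul h g b ∈ G.headSpace s t :=
  Submodule.le_topologicalClosure _ (Submodule.subset_span ⟨q, h, g, hg, b, rfl⟩)

theorem mul_mem_middleSpace {s q d r t : ℝ≥0} (h : s + q = t) (h' : d + r = q) (a : E.fiber s)
    {g : E.fiber d} (hg : g ∈ G.space d) (b : E.fiber r) :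
    E.mul h a (E.mul h' g b) ∈ G.middleSpace s d t :=
  Submodule.le_topologicalClosure _ (Submodule.subset_span ⟨q, r, h, h', a, g, hg, b, rfl⟩)

/-- The fiber of `G` at `s'` is generated by products over `s` and `s' - s`; the second factor joins
the free tail. -/
theorem headSpace_anti {s s' : ℝ≥0} (hs : s ≤ s') (t : ℝ≥0) :
    G.headSpace s' t ≤ G.headSpace s t := by
  refine Submodule.topologicalClosure_minimal _ (Submodule.span_le.mpr ?_)
    (G.isClosed_headSpace s t)
  rintro _ ⟨q, h, g, hg, b, rfl⟩
  have hd : s + (s' - s) = s' := add_tsub_cancel_of_le hs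
  have hq : s + ((s' - s) + q) = t := by rw [← add_assoc, hd, h]
  change g ∈ (G.headSpace s t).comap ((E.mulL h).flip b).toLinearMap
  rw [← G.mul_eq hd] at hg
  refine Submodule.topologicalClosure_minimal _ (Submodule.span_le.mpr ?_)
    ((G.isClosed_headSpace s t).preimage ((E.mulL h).flip b).continuous) hg
  rintro _ ⟨x, hx, y, -, rfl⟩
  change E.mul h (E.mul hd x y) b ∈ G.headSpace s t
  rw [← E.mul_assoc hd h rfl hq]
  exact G.mul_mem_headSpace hq hx _

/-- The projection acts as `p ⊗ 1`, with `p` the projection onto the fiber of `G` at `s`. It maps `a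
· g · b` to `(p a · g) · b`, and `p a · g` lies in `G` at time `s + d`. -/
theorem starProjection_headSpace_mem {s d s' t : ℝ≥0} (hs : s + d = s') {z : E.fiber t}
    (hz : z ∈ G.middleSpace s d t) : (G.headSpace s t).starProjection z ∈ G.headSpace s' t := by
  change z ∈ (G.headSpace s' t).comap (G.headSpace s t).starProjection.toLinearMap
  refine Submodule.topologicalClosure_minimal _ (Submodule.span_le.mpr ?_)
    ((G.isClosed_headSpace s' t).preimage (G.headSpace s t).starProjection.continuous) hz
  rintro _ ⟨q, r, h, h', a, g, hg, b, rfl⟩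
  have : CompleteSpace (G.space s) := (G.isClosed s).completeSpace_coe
  obtain ⟨a₁, ha₁, a₂, ha₂, rfl⟩ := (G.space s).exists_add_mem_mem_orthogonal a
  have hp : (G.headSpace s t).starProjection (E.mul h (a₁ + a₂) (E.mul h' g b)) =
      E.mul h a₁ (E.mul h' g b) := by
    refine Submodule.eq_starProjection_of_mem_orthogonal (G.mul_mem_headSpace h ha₁ _) ?_
    rw [← sub_mul, add_sub_cancel_left, headSpace, Submodule.orthogonal_closure,
      Submodule.mem_orthogonal]
    intro y hy
    induction hy using Submodule.span_induction with
    | zero => simp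
    | add a b _ _ ha hb => rw [inner_add_left, ha, hb, add_zero]
    | smul c a _ ha => rw [inner_smul_left, ha, mul_zero]
    | mem y hy =>
      obtain ⟨q', h₁, g', hg', b', rfl⟩ := hy
      obtain rfl : q' = q := add_left_cancel (h₁.trans h.symm)
      rw [inner_mul, (Submodule.mem_orthogonal _ _).mp ha₂ _ hg', zero_mul]
  change (G.headSpace s t).starProjection (E.mul h (a₁ + a₂) (E.mul h' g b)) ∈ G.headSpace s' t
  have h₂ : s' + r = t := by rw [← hs, add_assoc, h', h]
  rw [hp, E.mul_assoc hs h₂ h' h]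
  exact G.mul_mem_headSpace h₂ (G.mul_mem hs ha₁ hg) b

/-- With `P` the projection at time `s`, `P y` is a competitor at time `s'`, and Pythagoras splits
`z - P y` into `z - P z` and `P (z - y)`. -/
theorem norm_sub_starProjection_headSpace_sq_le {s d s' t : ℝ≥0} (hs : s + d = s')
    (z : E.fiber t) {y : E.fiber t} (hy : y ∈ G.middleSpace s d t) :
    ‖z - (G.headSpace s' t).starProjection z‖ ^ 2 ≤
      ‖z - (G.headSpace s t).starProjection z‖ ^ 2 + ‖z - y‖ ^ 2 := by
  set P := (G.headSpace s t).starProjection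
  have h1 : ‖z - (G.headSpace s' t).starProjection z‖ ≤ ‖z - P y‖ := by
    rw [Submodule.starProjection_minimal]
    exact ciInf_le ⟨0, by rintro _ ⟨_, rfl⟩; exact norm_nonneg _⟩
      (⟨P y, G.starProjection_headSpace_mem hs hy⟩ : G.headSpace s' t)
  have h2 : ‖z - P y‖ ^ 2 = ‖z - P z‖ ^ 2 + ‖P (z - y)‖ ^ 2 := by
    have h3 : (inner ℂ (z - P z) (P (z - y)) : ℂ) = 0 :=
      Submodule.inner_left_of_mem_orthogonal (Submodule.starProjection_apply_mem _ _)
        (Submodule.sub_starProjection_mem_orthogonal z)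
    have h4 : z - P y = (z - P z) + P (z - y) := by rw [map_sub]; abel
    rw [h4, norm_add_sq (𝕜 := ℂ), h3]
    simp
  have h5 : ‖P (z - y)‖ ≤ ‖z - y‖ := Submodule.norm_starProjection_apply_le _ _
  calc _ ≤ ‖z - P y‖ ^ 2 := by gcongr
    _ ≤ _ := by rw [h2]; gcongr

theorem norm_sub_starProjection_headSpace_mono {s s' : ℝ≥0} (hs : s ≤ s') {t : ℝ≥0}
    (z : E.fiber t) :
    ‖z - (G.headSpace s t).starProjection z‖ ≤ ‖z - (G.headSpace s' t).starProjection z‖ := by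
  rw [Submodule.starProjection_minimal]
  exact ciInf_le ⟨0, by rintro _ ⟨_, rfl⟩; exact norm_nonneg _⟩
    (⟨_, G.headSpace_anti hs t (Submodule.starProjection_apply_mem _ z)⟩ : G.headSpace s t)

/-- A vector which is approximated by the middle spaces of a subsystem up to errors `o(d)` lies in
the subsystem. -/
theorem mem_of_middleSpace_approx {e : ∀ t, E.fiber t} (he : E.IsUnitalSection e)
    (heG : e 0 ∈ G.space 0) {t : ℝ≥0} (z : E.fiber t) {C : ℝ} (hC : 0 ≤ C)
    (hz : ∀ s d : ℝ≥0, s + d ≤ t → ∃ y ∈ G.middleSpace s d t, ‖z - y‖ ^ 2 ≤ C * d)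
    (hz' : ∀ s < t, ∀ ε > 0, ∀ η : ℝ≥0, 0 < η → ∃ d : ℝ≥0, 0 < d ∧ d ≤ η ∧
      ∃ y ∈ G.middleSpace s d t, ‖z - y‖ ^ 2 ≤ ε * d) :
    z ∈ G.space t := by
  set f : ℝ → ℝ := fun s => ‖z - (G.headSpace s.toNNReal t).starProjection z‖ ^ 2 with hf
  have hcont : ContinuousOn f (Set.Icc 0 (t : ℝ)) := by
    refine LipschitzOnWith.continuousOn (K := C.toNNReal) (LipschitzOnWith.of_le_add_mul _ ?_)
    intro a ha b hb
    rw [Real.coe_toNNReal _ hC]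
    rcases le_total a b with hab | hab
    · have h1 : f a ≤ f b := by
        simp only [hf]
        gcongr ?_ ^ 2
        exact G.norm_sub_starProjection_headSpace_mono (Real.toNNReal_mono hab) z
      have := mul_nonneg hC (dist_nonneg (x := a) (y := b))
      linarith
    · have hba : b.toNNReal + (a - b).toNNReal = a.toNNReal := by
        rw [← Real.toNNReal_add hb.1 (sub_nonneg.mpr hab), add_sub_cancel]
      obtain ⟨y, hy, hyz⟩ := hz b.toNNReal (a - b).toNNReal
        (by rw [hba]; exact Real.toNNReal_le_iff_le_coe.mpr ha.2)
      have h1 := G.norm_sub_starProjection_headSpace_sq_le hba z hy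
      rw [Real.coe_toNNReal _ (sub_nonneg.mpr hab)] at hyz
      rw [Real.dist_eq, abs_of_nonneg (sub_nonneg.mpr hab)]
      exact h1.trans (by simpa [hf] using hyz)
  have h0 : f 0 ≤ 0 := by
    have h1 : z ∈ G.headSpace 0 t := by
      rw [← he.zero_mul (zero_add t) z]
      exact G.mul_mem_headSpace _ heG z
    simp only [hf, Real.toNNReal_zero]
    rw [Submodule.starProjection_eq_self_iff.mpr h1]
    simp
  -- It is enough to find small slopes for some `d` arbitrarily close to 0. The error rate `ρ / 2`
  -- below gives the strict inequality required.
  have key := image_le_of_liminf_slope_right_le_deriv_boundary (B := fun _ => 0)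
    (B' := fun _ => 0) hcont h0 continuousOn_const
    (fun x _ => hasDerivWithinAt_const x _ _) (by
      intro s hs ρ hρ
      rw [Filter.frequently_iff]
      intro U hU
      obtain ⟨b, hb, hbU⟩ := mem_nhdsGT_iff_exists_Ioo_subset.mp hU
      have hst : s.toNNReal < t := by
        rw [Real.toNNReal_lt_iff_lt_coe hs.1]; exact hs.2
      have hbs : 0 < b - s := sub_pos.mpr hb
      obtain ⟨d, hd, hdη, y, hy, hyz⟩ := hz' s.toNNReal hst (ρ / 2) (half_pos hρ)
        ((b - s) / 2).toNNReal (Real.toNNReal_pos.mpr (half_pos hbs))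
      have hd' : (0 : ℝ) < d := hd
      have hdb : (d : ℝ) ≤ (b - s) / 2 := by
        rw [← Real.coe_toNNReal _ (half_pos hbs).le]; exact hdη
      refine ⟨s + d, hbU ⟨by linarith, by linarith⟩, ?_⟩
      have hsd : s.toNNReal + d = (s + d).toNNReal := by
        rw [Real.toNNReal_add hs.1 hd'.le, Real.toNNReal_coe]
      have h1 := G.norm_sub_starProjection_headSpace_sq_le hsd z hy
      have h2 : f (s + d) ≤ f s + ρ / 2 * d := h1.trans (by simpa [hf] using hyz)
      rw [slope_def_field, add_sub_cancel_left, div_lt_iff₀ hd']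
      nlinarith)
  have ht := key (Set.right_mem_Icc.mpr t.2)
  have hzt : z ∈ G.headSpace t t := by
    rw [← Submodule.starProjection_eq_self_iff]
    simp only [hf, Real.toNNReal_coe] at ht
    have := pow_eq_zero_iff (two_ne_zero) |>.mp (le_antisymm ht (sq_nonneg _))
    exact (sub_eq_zero.mp (norm_eq_zero.mp this)).symm
  -- At `s = t` the tail `b` lives at time 0. Slicing `g · b` against `e 0` leaves a multiple of
  -- `g`, while slicing `z = z · e 0` returns `z`.
  have h1 : G.headSpace t t ≤ (G.space t).comap (mulRightAdj (add_zero t) (e 0)).toLinearMap := by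
    refine Submodule.topologicalClosure_minimal _ (Submodule.span_le.mpr ?_)
      ((G.isClosed t).preimage (mulRightAdj (add_zero t) (e 0)).continuous)
    rintro _ ⟨q, h, g, hg, b, rfl⟩
    obtain rfl : q = 0 := by simpa using h
    change mulRightAdj (add_zero t) (e 0) (E.mul h g b) ∈ G.space t
    rw [mulRightAdj_mul]
    exact (G.space t).smul_mem _ hg
  have h2 : mulRightAdj (add_zero t) (e 0) z ∈ G.space t := h1 hzt
  rwa [← he.mul_zero (add_zero t) z, mulRightAdj_mul, he.inner_self, one_smul] at h2

end Subsystem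

/-! ### Tensoring an arbitrary vector with a unit -/

theorem norm_sub_inner_smul_sq {X : Type*} [NormedAddCommGroup X] [InnerProductSpace ℂ X]
    {a b : X} (ha : ‖a‖ = 1) (hb : ‖b‖ = 1) :
    ‖b - (inner ℂ a b : ℂ) • a‖ ^ 2 = 1 - ‖(inner ℂ a b : ℂ)‖ ^ 2 := by
  rw [norm_sub_sq (𝕜 := ℂ), inner_smul_right, ← inner_conj_symm b a, RCLike.mul_conj, norm_smul,
    ha, hb, ← RCLike.ofReal_pow, RCLike.ofReal_re]
  ring

theorem IsUnitalSection.tensorMk {u : ∀ t, E.fiber t} {v : ∀ t, F.fiber t}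
    (hu : E.IsUnitalSection u) (hv : F.IsUnitalSection v) :
    (E.tensor F).IsUnitalSection fun t => ArvesonSystem.tensorMk E F t (u t) (v t) where
  norm_eq t := by rw [norm_tensorMk, hu.norm_eq, hv.norm_eq, one_mul]
  mul_eq h := by rw [mul_tensorMk, hu.mul_eq, hv.mul_eq]

/-- The tensor product of `E_t` and a unit lies in every subsystem that contains `u ⊗ F` and
`E ⊗ v`. -/
theorem tensorMk_unital_mem {u : ∀ t, E.fiber t} {v w : ∀ t, F.fiber t}
    (hu : E.IsUnitalSection u) (hv : F.IsUnitalSection v) (hw : F.IsUnitalSection w)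
    (G : (E.tensor F).Subsystem) (hGu : ∀ t y, tensorMk E F t (u t) y ∈ G.space t)
    (hGv : ∀ t x, tensorMk E F t x (v t) ∈ G.space t) (t : ℝ≥0) (x : E.fiber t) :
    tensorMk E F t x (w t) ∈ G.space t := by
  obtain ⟨C, hC, hCd⟩ := hv.exists_one_sub_norm_inner_sq_le hw
  have key : ∀ s d : ℝ≥0, s + d ≤ t → ∀ p ∈ insertSpan u s d t, ∃ y ∈ G.middleSpace s d t,
      ‖tensorMk E F t x (w t) - y‖ ^ 2 ≤ C * d * ‖x - p‖ ^ 2 := by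
    intro s d hsd p hp
    obtain ⟨r, hr⟩ := exists_add_of_le hsd
    have h' : d + r = d + r := rfl
    have h : s + (d + r) = t := by rw [hr, add_assoc]
    -- `ω` is `w t` with `w` replaced by `v` during `[s, s + d]`.
    set ω := F.mul h (w s) (F.mul h' (v d) (w r)) with hω
    have hω1 : ‖ω‖ = 1 := by
      rw [hω, norm_mul, norm_mul, hw.norm_eq, hw.norm_eq, hv.norm_eq]; norm_num
    have hin : (inner ℂ ω (w t) : ℂ) = inner ℂ (v d) (w d) := by
      rw [hω, ← hw.mul_eq h, ← hw.mul_eq h', inner_mul, inner_mul, hw.inner_self, hw.inner_self,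
        one_mul, mul_one]
    have hpm : tensorMk E F t p (w t) ∈ G.middleSpace s d t := by
      change p ∈ (G.middleSpace s d t).comap ((tensorMk E F t).flip (w t)).toLinearMap
      refine Submodule.span_le.mpr ?_ hp
      rintro _ ⟨q, r, h, h', a, b, rfl⟩
      change tensorMk E F t (E.mul h a (E.mul h' (u d) b)) (w t) ∈ G.middleSpace s d t
      rw [← hw.mul_eq h, ← hw.mul_eq h', ← mul_tensorMk, ← mul_tensorMk]
      exact G.mul_mem_middleSpace h h' _ (hGu d _) _
    have hωm : ∀ z, tensorMk E F t z ω ∈ G.middleSpace s d t := by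
      refine mem_of_mul_mem h
        ((G.middleSpace s d t).comap ((tensorMk E F t).flip ω).toLinearMap)
        ((G.isClosed_middleSpace s d t).preimage ((tensorMk E F t).flip ω).continuous)
        fun a z => ?_
      refine mem_of_mul_mem h'
        ((G.middleSpace s d t).comap
          (((tensorMk E F t).flip ω).comp (E.mulL h a)).toLinearMap)
        ((G.isClosed_middleSpace s d t).preimage
          (((tensorMk E F t).flip ω).comp (E.mulL h a)).continuous)
        (fun y b => ?_) z
      change tensorMk E F t (E.mul h a (E.mul h' y b)) ω ∈ G.middleSpace s d t
      rw [hω, ← mul_tensorMk, ← mul_tensorMk]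
      exact G.mul_mem_middleSpace h h' _ (hGv d _) _
    -- The second summand is the projection of the remainder `(x - p) ⊗ w t` onto `E_t ⊗ ω`.
    refine ⟨tensorMk E F t p (w t) + (inner ℂ ω (w t) : ℂ) • tensorMk E F t (x - p) ω,
      Submodule.add_mem _ hpm (Submodule.smul_mem _ _ (hωm _)), ?_⟩
    have h1 : tensorMk E F t x (w t) -
        (tensorMk E F t p (w t) + (inner ℂ ω (w t) : ℂ) • tensorMk E F t (x - p) ω) =
        tensorMk E F t (x - p) (w t - (inner ℂ ω (w t) : ℂ) • ω) := by
      simp only [map_sub, map_smul, sub_apply, smul_sub]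
      abel
    rw [h1, norm_tensorMk, mul_pow, norm_sub_inner_smul_sq hω1 (hw.norm_eq t), hin,
      _root_.mul_comm]
    gcongr
    exact hCd d
  refine G.mem_of_middleSpace_approx (hu.tensorMk hv) (hGu 0 _) _ (C := C * ‖x‖ ^ 2)
    (by positivity) (fun s d hsd => ?_) (fun s hst ε hε η hη => ?_)
  -- With `p = 0` the bound is linear in `d`, which yields the continuity of the distance function.
  · obtain ⟨y, hy, hle⟩ := key s d hsd 0 (Submodule.zero_mem _)
    refine ⟨y, hy, hle.trans_eq ?_⟩
    rw [sub_zero]; ring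
  · obtain ⟨ρ, hρ, hρε⟩ : ∃ ρ : ℝ, 0 < ρ ∧ C * ρ ^ 2 ≤ ε := by
      -- `C + 1` avoids division by zero, as `C` may vanish.
      refine ⟨√(ε / (C + 1)), by positivity, ?_⟩
      rw [Real.sq_sqrt (by positivity), mul_div_assoc', div_le_iff₀ (by positivity)]
      nlinarith
    obtain ⟨d, hd, hdη, p, hp, hlt⟩ := hu.exists_mem_insertSpan hst x hρ
      (lt_min hη (tsub_pos_of_lt hst))
    have hsd : s + d ≤ t := by
      rw [← add_tsub_cancel_of_le hst.le]
      gcongr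
      exact hdη.trans (min_le_right _ _)
    obtain ⟨y, hy, hle⟩ := key s d hsd p hp
    refine ⟨d, hd, hdη.trans (min_le_left _ _), y, hy, hle.trans ?_⟩
    calc C * d * ‖x - p‖ ^ 2 ≤ C * d * ρ ^ 2 := by gcongr
      _ = C * ρ ^ 2 * d := by ring
      _ ≤ ε * d := by gcongr

/-! ### The slice of a subsystem of a tensor product -/

/-- The adjoint of the left multiplication by `y`. -/
noncomputable def mulLeftAdj {s t r : ℝ≥0} (h : s + t = r) (y : E.fiber s) :
    E.fiber r →L[ℂ] E.fiber t :=
  ContinuousLinearMap.adjoint (E.mulL h y)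

theorem mulLeftAdj_mul {s t r : ℝ≥0} (h : s + t = r) (y : E.fiber s) (a : E.fiber s)
    (b : E.fiber t) : mulLeftAdj h y (E.mul h a b) = (inner ℂ y a : ℂ) • b := by
  refine ext_inner_left ℂ fun e => ?_
  rw [mulLeftAdj, ContinuousLinearMap.adjoint_inner_right, inner_smul_right]
  exact E.inner_mul h y a e b

/-- A vector all of whose left and right slices lie in closed subspaces `P` and `Q` lies in the
closed span of the products of `P` and `Q`. -/
theorem mem_topologicalClosure_span_mul {s t r : ℝ≥0} (h : s + t = r)
    {P : Submodule ℂ (E.fiber s)} {Q : Submodule ℂ (E.fiber t)}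
    (hP : IsClosed (P : Set (E.fiber s))) (hQ : IsClosed (Q : Set (E.fiber t))) {x : E.fiber r}
    (hr : ∀ b, mulRightAdj h b x ∈ P) (hl : ∀ a, mulLeftAdj h a x ∈ Q) :
    x ∈ (Submodule.span ℂ (Set.image2 (E.mul h) (P : Set (E.fiber s))
      (Q : Set (E.fiber t)))).topologicalClosure := by
  set M := (Submodule.span ℂ (Set.image2 (E.mul h) (P : Set (E.fiber s))
    (Q : Set (E.fiber t)))).topologicalClosure with hM
  have : CompleteSpace M := (Submodule.isClosed_topologicalClosure _).completeSpace_coe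
  have : CompleteSpace P := hP.completeSpace_coe
  have : CompleteSpace Q := hQ.completeSpace_coe
  have hMr : ∀ b, M ≤ P.comap (mulRightAdj h b).toLinearMap := fun b => by
    refine Submodule.topologicalClosure_minimal _ (Submodule.span_le.mpr ?_)
      (hP.preimage (mulRightAdj h b).continuous)
    rintro _ ⟨a, ha, b', -, rfl⟩
    change mulRightAdj h b (E.mul h a b') ∈ P
    rw [mulRightAdj_mul]
    exact P.smul_mem _ ha
  have hMl : ∀ a, M ≤ Q.comap (mulLeftAdj h a).toLinearMap := fun a => by
    refine Submodule.topologicalClosure_minimal _ (Submodule.span_le.mpr ?_)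
      (hQ.preimage (mulLeftAdj h a).continuous)
    rintro _ ⟨a', -, b, hb, rfl⟩
    change mulLeftAdj h a (E.mul h a' b) ∈ Q
    rw [mulLeftAdj_mul]
    exact Q.smul_mem _ hb
  have hMx : M.starProjection x ∈ M := Submodule.starProjection_apply_mem _ _
  have hxM := (Submodule.mem_orthogonal _ _).mp
    (Submodule.sub_starProjection_mem_orthogonal (K := M) x)
  set z := x - M.starProjection x with hz
  -- The slices of `z` stay in `P` and `Q`, so `z` is orthogonal to every product with a factor in
  -- `Pᗮ` or `Qᗮ`; being orthogonal to `M` covers the remaining products.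
  have hzP : ∀ a ∈ Pᗮ, ∀ b, inner ℂ (E.mul h a b) z = 0 := fun a ha b => by
    have := (Submodule.mem_orthogonal' _ _).mp ha (mulRightAdj h b z)
      (by rw [hz, map_sub]; exact P.sub_mem (hr b) (hMr b hMx))
    rwa [mulRightAdj, ContinuousLinearMap.adjoint_inner_right] at this
  have hzQ : ∀ a, ∀ b ∈ Qᗮ, inner ℂ (E.mul h a b) z = 0 := fun a b hb => by
    have := (Submodule.mem_orthogonal' _ _).mp hb (mulLeftAdj h a z)
      (by rw [hz, map_sub]; exact Q.sub_mem (hl a) (hMl a hMx))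
    rwa [mulLeftAdj, ContinuousLinearMap.adjoint_inner_right] at this
  have hzero : z = 0 := by
    refine isTotalSet_iff.mp (E.isTotalSet_mul h isTotalSet_univ isTotalSet_univ) _ ?_
    rintro _ ⟨a, -, b, -, rfl⟩
    have h1 := hzP _ (Submodule.sub_starProjection_mem_orthogonal (K := P) a) b
    have h2 := hzQ (P.starProjection a) _ (Submodule.sub_starProjection_mem_orthogonal (K := Q) b)
    have h3 := hxM (E.mul h (P.starProjection a) (Q.starProjection b))
      (Submodule.le_topologicalClosure _ (Submodule.subset_span
        ⟨_, Submodule.starProjection_apply_mem _ _, _, Submodule.starProjection_apply_mem _ _,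
          rfl⟩))
    rw [sub_mul, inner_sub_left, sub_eq_zero] at h1
    rw [mul_sub, inner_sub_left, sub_eq_zero] at h2
    rw [h1, h2, h3]
  rw [sub_eq_zero.mp (hz.symm.trans hzero)]
  exact hMx

/-- This turns a slice in `F` into a slice in `E ⊗ F`, under which `G` is stable. The unit vector
`a` is padding: it extends `x` to time `r` and is paired away again. In `Subsystem.slice` the unit
of `E` supplies it. -/
theorem tensorMk_mulRightAdj {s t r : ℝ≥0} (h : s + t = r) {a : E.fiber t} (ha : ‖a‖ = 1)
    (b : F.fiber t) (x : E.fiber s) (y : F.fiber r) :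
    tensorMk E F s x (mulRightAdj h b y) =
      mulRightAdj h (tensorMk E F t a b) (tensorMk E F r (E.mul h x a) y) := by
  refine mem_of_mul_mem h
    (LinearMap.eqLocus ((tensorMk E F s x).comp (mulRightAdj h b)).toLinearMap
      ((mulRightAdj h (tensorMk E F t a b)).comp (tensorMk E F r (E.mul h x a))).toLinearMap)
    (isClosed_eq ((tensorMk E F s x).comp (mulRightAdj h b)).continuous
      ((mulRightAdj h (tensorMk E F t a b)).comp (tensorMk E F r (E.mul h x a))).continuous)
    (fun c d => ?_) y
  change tensorMk E F s x (mulRightAdj h b (F.mul h c d)) =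
    mulRightAdj h (tensorMk E F t a b) (tensorMk E F r (E.mul h x a) (F.mul h c d))
  rw [mulRightAdj_mul, ← mul_tensorMk, mulRightAdj_mul, inner_tensorMk,
    inner_self_eq_norm_sq_to_K, ha, map_smul]
  simp

theorem tensorMk_mulLeftAdj {s t r : ℝ≥0} (h : s + t = r) {a : E.fiber s} (ha : ‖a‖ = 1)
    (b : F.fiber s) (x : E.fiber t) (y : F.fiber r) :
    tensorMk E F t x (mulLeftAdj h b y) =
      mulLeftAdj h (tensorMk E F s a b) (tensorMk E F r (E.mul h a x) y) := by
  refine mem_of_mul_mem h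
    (LinearMap.eqLocus ((tensorMk E F t x).comp (mulLeftAdj h b)).toLinearMap
      ((mulLeftAdj h (tensorMk E F s a b)).comp (tensorMk E F r (E.mul h a x))).toLinearMap)
    (isClosed_eq ((tensorMk E F t x).comp (mulLeftAdj h b)).continuous
      ((mulLeftAdj h (tensorMk E F s a b)).comp (tensorMk E F r (E.mul h a x))).continuous)
    (fun c d => ?_) y
  change tensorMk E F t x (mulLeftAdj h b (F.mul h c d)) =
    mulLeftAdj h (tensorMk E F s a b) (tensorMk E F r (E.mul h a x) (F.mul h c d))
  rw [mulLeftAdj_mul, ← mul_tensorMk, mulLeftAdj_mul, inner_tensorMk,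
    inner_self_eq_norm_sq_to_K, ha, map_smul]
  simp

/-- The subsystem of `F` of the vectors `y` such that `E_t ⊗ y` lies in a given subsystem of
`E ⊗ F`, for a spatial system `E`. -/
noncomputable def Subsystem.slice {u : ∀ t, E.fiber t} (hu : E.IsUnitalSection u)
    (G : (E.tensor F).Subsystem) : F.Subsystem where
  space t := ⨅ x, (G.space t).comap (tensorMk E F t x).toLinearMap
  isClosed t := by
    simp only [Submodule.coe_iInf]
    exact isClosed_iInter fun x => (G.isClosed t).preimage (tensorMk E F t x).continuous
  mul_eq := by
    intro s t r h
    have hcl : ∀ t, IsClosed ((⨅ x, (G.space t).comap (tensorMk E F t x).toLinearMap :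
        Submodule ℂ (F.fiber t)) : Set (F.fiber t)) := fun t => by
      simp only [Submodule.coe_iInf]
      exact isClosed_iInter fun x => (G.isClosed t).preimage (tensorMk E F t x).continuous
    apply le_antisymm
    · refine Submodule.topologicalClosure_minimal _ (Submodule.span_le.mpr ?_) (hcl r)
      rintro _ ⟨a, ha, b, hb, rfl⟩
      simp only [SetLike.mem_coe, Submodule.mem_iInf] at ha hb ⊢
      refine fun x => mem_of_mul_mem h
        ((G.space r).comap ((tensorMk E F r).flip (F.mul h a b)).toLinearMap)
        ((G.isClosed r).preimage ((tensorMk E F r).flip (F.mul h a b)).continuous)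
        (fun c d => ?_) x
      change tensorMk E F r (E.mul h c d) (F.mul h a b) ∈ G.space r
      rw [← mul_tensorMk]
      exact G.mul_mem h (ha c) (hb d)
    · intro y hy
      simp only [Submodule.mem_iInf] at hy
      refine mem_topologicalClosure_span_mul h (hcl s) (hcl t) (fun b => ?_) (fun b => ?_)
      · simp only [Submodule.mem_iInf]
        intro x
        change tensorMk E F s x (mulRightAdj h b y) ∈ G.space s
        rw [tensorMk_mulRightAdj h (hu.norm_eq t)]
        exact G.adjoint_right_mem h _ (hy _)
      · simp only [Submodule.mem_iInf]
        intro x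
        change tensorMk E F t x (mulLeftAdj h b y) ∈ G.space t
        rw [tensorMk_mulLeftAdj h (hu.norm_eq s)]
        exact G.adjoint_left_mem h _ (hy _)

theorem Subsystem.mem_slice {u : ∀ t, E.fiber t} (hu : E.IsUnitalSection u)
    (G : (E.tensor F).Subsystem) {t : ℝ≥0} {y : F.fiber t} :
    y ∈ (G.slice hu).space t ↔ ∀ x, tensorMk E F t x y ∈ G.space t := by
  simp only [Subsystem.slice, Submodule.mem_iInf]
  rfl

/-- The generating units of a type I system need not have norm one; rescaling keeps them
multiplicative because the norm is multiplicative on products. -/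
theorem IsUnitSection.normalize {w : ∀ t, F.fiber t} (hw : F.IsUnitSection w) :
    F.IsUnitalSection fun t => ((‖w t‖⁻¹ : ℝ) : ℂ) • w t where
  norm_eq t := by
    rw [norm_smul, Complex.norm_real, norm_inv, norm_norm,
      inv_mul_cancel₀ (norm_ne_zero_iff.mpr (hw.ne_zero t))]
  mul_eq {s t r} h := by
    rw [← mulL_apply, map_smul, map_smul, smul_apply, mulL_apply, smul_smul, ← hw.mul h, norm_mul,
      mul_inv, Complex.ofReal_mul, _root_.mul_comm]

end ArvesonSystem

/-- If `(E, x)` and `(F, y)` are spatial Arveson systems and `F` is of type I, then the spatial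
product of `(E, x)` and `(F, y)` is the whole tensor product `E ⊗ F`. -/
theorem mainTheorem3 (E : ArvesonSystem.{u}) (F : ArvesonSystem.{v})
    (x : E.UnitalUnit) (y : F.UnitalUnit) (hF : F.IsTypeI) :
    ArvesonSystem.spatialProduct x y = ⊤ := by
  set G := ArvesonSystem.spatialProduct x y
  have hx := x.isUnitalSection
  have hslice : G.slice hx = ⊤ := by
    rw [eq_top_iff, ← (hF : F.unitSubsystem = ⊤)]
    -- `F` is the smallest subsystem containing all units, so it suffices that the slice contains
    -- each unit; the normalising scalar is removed at the end.
    refine sInf_le fun w hw t => (G.mem_slice hx).mpr fun z => ?_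
    have h := ArvesonSystem.tensorMk_unital_mem hx y.isUnitalSection hw.normalize G
      (fun t b => (le_sup_left : ArvesonSystem.unitTensor x F ≤ G) t ⟨b, rfl⟩)
      (fun t a => (le_sup_right : ArvesonSystem.tensorUnit E y ≤ G) t ⟨a, rfl⟩) t z
    rw [map_smul] at h
    refine ((G.space t).smul_mem_iff ?_).mp h
    exact Complex.ofReal_ne_zero.mpr (inv_ne_zero (norm_ne_zero_iff.mpr (hw.ne_zero t)))
  refine ArvesonSystem.Subsystem.ext fun t => ?_
  rw [ArvesonSystem.Subsystem.space_top, eq_top_iff]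
  intro z _
  refine (HilbertTensor.isTotalSet_tmul HilbertTensor.isTotalSet_univ
    HilbertTensor.isTotalSet_univ).mem_of_isClosed (G.space t) (G.isClosed t) ?_ z
  rintro _ ⟨a, -, b, -, rfl⟩
  exact (G.mem_slice hx).mp (by rw [hslice]; trivial) a
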